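/- **Notation.** For $F\subset\mathbb R^d$ let $F_\varepsilon=\{x : d(x,F)\le\varepsilon\}$ be its $\varepsilon$-parallel set, and let $\mathcal R^d$ be the convex ring, i.e. the class of finite unions of compact convex subsets of $\mathbb R^d$. For compact convex $K$ with nearest-point map $p_K$, the curvature measures $C_0(K,\cdot),\dots,C_d(K,\cdot)$ are defined by the local Steiner formula $$\mathcal L^d\big(p_K^{-1}(B)\cap K_\varepsilon\big)=\sum_{j=0}^d\varepsilon^{d-j}\kappa_{d-j}\,C_j(K,B)\qquad(\varepsilon>0,\ B\text{ Borel}),$$ where $\kappa_j$ is the volume of the $j$-dimensional unit ball; they are extended to signed measures $C_j(F,\cdot)$ for $F\in\mathcal R^d$ by the inclusion–exclusion principle. Write $C_j(F)=C_j(F,\mathbb R^d)$ and let $C_j^{var}(F)$ be the total mass of the total variation measure of $C_j(F,\cdot)$. The scaling exponents are $$s_j(F)=\inf\{t\in\mathbb R:\lim_{\varepsilon\downarrow0}\varepsilon^tC_j^{var}(F_\varepsilon)=0\},$$ and for compact $F$ with $F_\varepsilon\in\mathcal R^d$ for all $\varepsilon\in(0,\varepsilon_0]$, some $\varepsilon_0>0$,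 the average fractal curvatures are $$\overline C_j^f(F)=\lim_{\delta\downarrow0}\frac1{\log\varepsilon_0-\log\delta}\int_\delta^{\varepsilon_0}\varepsilon^{s_j(F)}C_j(F_\varepsilon)\,\frac{d\varepsilon}{\varepsilon}$$ whenever $s_j(F)$ is finite and the integrals and the limit exist. For a compact set $A\subset\mathbb R^d$, the specific fractal curvatures $$\Xi_k(A)=\overline C_k^f(A)/\overline C_d^f(A),\qquad k\in\{0,\dots,d-1\},$$ are called well defined if $\overline C_j^f(A)$ exists for all $j\in\{0,\dots,d\}$ and $\overline C_d^f(A)>0$. **Proposition.** Let $A\subset\mathbb R^d$ be a compact set whose specific fractal curvatures are well defined, let $k\in\{0,\dots,d-1\}$ and $\lambda>0$. 1. If $A\in\mathcal R^d$ and $A$ has positive volume, then $\Xi_k(\lambda A)$ is well defined and $\Xi_k(\lambda A)=\lambda^{k-d}\,\Xi_k(A)$. 2. If there is a real number $s$ with $s_j(A)=s-j$ for all $j\in\{0,\dots,d\}$, then $\Xi_k(\lambda A)$ is well defined and $\Xi_k(\lambda A)=\Xi_k(A)$. -/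

import Mathlib

open Set Filter Topology MeasureTheory
open scoped Pointwise

namespace FractalCurvature

noncomputable section

/-- Euclidean space `ℝ^d`. -/
abbrev E (d : ℕ) : Type := EuclideanSpace ℝ (Fin d)

/-- `κ_j`, the volume of the `j`-dimensional Euclidean unit ball. -/
def unitBallVolume (j : ℕ) : ℝ := (volume (Metric.closedBall (0 : E j) 1)).toReal

/-- The local parallel set `U_ε(K, B) = p_K⁻¹(B) ∩ K_ε`: all points at distance at most `ε` from
`K` whose nearest point in `K` lies in `B`. -/
def localParallelSet {d : ℕ} (ε : ℝ) (K B : Set (E d)) : Set (E d) :=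
  {x | ∃ y ∈ K ∩ B, (∀ z ∈ K, dist x y ≤ dist x z) ∧ dist x y ≤ ε}

/-- `c 0, …, c d` are the coefficients in the local Steiner formula of `K` at `B`. -/
def IsSteinerCoeff {d : ℕ} (K B : Set (E d)) (c : Fin (d + 1) → ℝ) : Prop :=
  ∀ ε : ℝ, 0 < ε → (volume (localParallelSet ε K B)).toReal =
    ∑ j : Fin (d + 1), ε ^ (d - (j : ℕ)) * unitBallVolume (d - (j : ℕ)) * c j

open Classical in
/-- The curvature measures `C_j(K, B)` of a compact convex set `K`, for a Borel set `B`: the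
coefficients in the local Steiner formula (these are unique). -/
def convexCurvature {d : ℕ} (j : Fin (d + 1)) (K B : Set (E d)) : ℝ :=
  if h : ∃ c : Fin (d + 1) → ℝ, IsSteinerCoeff K B c then h.choose j else 0

/-- `K 0, …, K (m-1)` are compact convex sets with union `F`. -/
def IsConvexRepr {d : ℕ} (F : Set (E d)) (m : ℕ) (K : Fin m → Set (E d)) : Prop :=
  (∀ i, IsCompact (K i) ∧ Convex ℝ (K i)) ∧ F = ⋃ i, K i

/-- `F` belongs to the convex ring, i.e. it is a finite union of compact convex sets. -/
def IsPolyconvex {d : ℕ} (F : Set (E d)) : Prop :=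
  ∃ (m : ℕ) (K : Fin m → Set (E d)), IsConvexRepr F m K

open Classical in
/-- The (signed) curvature measures `C_j(F, B)` of a polyconvex set `F`, by inclusion-exclusion
over a representation of `F` as a finite union of compact convex sets. (The value does not depend
on the representation.) -/
def curvature {d : ℕ} (j : Fin (d + 1)) (F B : Set (E d)) : ℝ :=
  if h : IsPolyconvex F then
    ∑ I : Finset (Fin h.choose) with I.Nonempty,
      (-1 : ℝ) ^ (I.card - 1) * convexCurvature j (⋂ i ∈ I, h.choose_spec.choose i) B
  else 0

/-- The total curvature `C_j(F) = C_j(F, ℝ^d)`. -/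
def totalCurvature {d : ℕ} (j : Fin (d + 1)) (F : Set (E d)) : ℝ := curvature j F univ

/-- The positive variation `μ⁺(A)` of a signed measure `μ`. -/
def posVariation {d : ℕ} (μ : Set (E d) → ℝ) (A : Set (E d)) : ℝ :=
  sSup {x | ∃ B, MeasurableSet B ∧ B ⊆ A ∧ x = μ B}

/-- The negative variation `μ⁻(A)` of a signed measure `μ`. -/
def negVariation {d : ℕ} (μ : Set (E d) → ℝ) (A : Set (E d)) : ℝ :=
  -sInf {x | ∃ B, MeasurableSet B ∧ B ⊆ A ∧ x = μ B}

/-- The total variation `C_j^var(F)` of the signed measure `C_j(F, ·)`. -/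
def curvatureVar {d : ℕ} (j : Fin (d + 1)) (F : Set (E d)) : ℝ :=
  posVariation (curvature j F) univ + negVariation (curvature j F) univ

/-- The (upper) curvature scaling exponent
`s_j(F) = inf {t ∈ ℝ | lim_{ε ↓ 0} ε^t C_j^var(F_ε) = 0}`, as an extended real number. The parallel
set `F_ε` is `Metric.cthickening ε F`. -/
def scalingExponent {d : ℕ} (j : Fin (d + 1)) (F : Set (E d)) : EReal :=
  sInf ((fun t : ℝ => (t : EReal)) ''
    {t : ℝ | Tendsto (fun ε : ℝ => ε ^ t * curvatureVar j (Metric.cthickening ε F))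
      (𝓝[>] 0) (𝓝 0)})

/-- The average fractal curvature of index `j` of the compact set `F` exists and equals `c`: the
parallel sets `F_ε` are polyconvex for `0 < ε ≤ ε₀`, the scaling exponent `s = s_j(F)` is finite,
and the logarithmic averages of `ε^s C_j(F_ε)` over `[δ, ε₀]` are defined and tend to `c` as
`δ ↓ 0`. (The value `c` does not depend on `ε₀`.) -/
def HasAverageFractalCurvature {d : ℕ} (j : Fin (d + 1)) (F : Set (E d)) (c : ℝ) : Prop :=
  IsCompact F ∧ ∃ s : ℝ, scalingExponent j F = (s : EReal) ∧ ∃ ε₀ : ℝ, 0 < ε₀ ∧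
    (∀ ε ∈ Ioc 0 ε₀, IsPolyconvex (Metric.cthickening ε F)) ∧
    (∀ δ ∈ Ioo 0 ε₀, IntervalIntegrable
      (fun ε : ℝ => ε ^ s * totalCurvature j (Metric.cthickening ε F) / ε) volume δ ε₀) ∧
    Tendsto (fun δ : ℝ => 1 / (Real.log ε₀ - Real.log δ) *
      ∫ ε in δ..ε₀, ε ^ s * totalCurvature j (Metric.cthickening ε F) / ε) (𝓝[>] 0) (𝓝 c)

open Classical in
/-- The average fractal curvature of index `j`, with value `0` where it does not exist. -/
def averageFractalCurvature {d : ℕ} (j : Fin (d + 1)) (F : Set (E d)) : ℝ :=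
  if h : ∃ c, HasAverageFractalCurvature j F c then h.choose else 0

/-- The specific fractal curvatures of `A` are well defined: all average fractal curvatures of `A`
exist and the one of index `d` is positive. -/
def SpecificCurvatureWellDefined {d : ℕ} (A : Set (E d)) : Prop :=
  (∀ j : Fin (d + 1), ∃ c, HasAverageFractalCurvature j A c) ∧
    0 < averageFractalCurvature (Fin.last d) A

/-- The specific fractal curvature `Ξ_k(A)`, `k ∈ {0, …, d - 1}`. -/
def specificCurvature {d : ℕ} (k : Fin d) (A : Set (E d)) : ℝ :=
  averageFractalCurvature k.castSucc A / averageFractalCurvature (Fin.last d) A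

end

end FractalCurvature

/-! Total curvature is homogeneous, `C_j(rF) = r^j C_j(F)`, and `(rA)_ε = r A_{ε/r}`. The
substitution `ε = rη` preserves `dε/ε`, so scaling exponents do not change and the average fractal
curvature of index `j` is multiplied by `r^(s_j + j)`. The quotient is therefore multiplied by
`r^(s_k + k - s_d - d)` (`specificCurvature_smul`). If `s_j = s - j` this exponent vanishes; for a
polyconvex set of positive volume it remains to show `s_j = 0` for every `j`.

The definitions choose Steiner coefficients and a convex representation, so two classical facts are
needed. The local Steiner formula (`exists_shell_polynomial`) comes from sliding points along the
rays from their nearest points: the Jacobian is a polynomial in the sliding factor because the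
differential of the nearest-point map is symmetric with spectrum in `[0, 1]`. Independence of the
representation (`IsConvexRepr.curvature_eq`) is reduced to additivity of the Euler characteristic.

For `s_j = 0`, the variation of `C_j(A_ε, ·)` is bounded for `ε ≤ 1`, and it must be shown not to
tend to `0`. For `j = d` it is at least the volume of `A`. For `k < d`, a piece of the boundary of
`A_ε` is found on which the curvature measure is that of one convex parallel body and stays bounded
below (`IsConvexRepr.curvature_contactSurface`). To see that such a piece exists, split the space by
orthogonal projections `P`, `Q` of ranks `k`, `d - k`. For almost every `z ∈ A`, maximizing `⟨Q z,
·⟩` over the slice of `A` through `z` yields a point `q` with a normal `u` common to all convex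
pieces through `q`, where `P q + Q u = z` (`ae_exists_mem_contactSet`). These pairs `(q, u)` cover
positive volume, so a Sard argument (`IsSplitting.volume_image_eq_zero`) makes the relevant Steiner
coefficient positive. -/

namespace FractalCurvature

/-! ### The nearest-point map of a convex body and its differential. -/

/-- A nonempty compact convex set. -/
structure IsBody {d : ℕ} (K : Set (E d)) : Prop where
  compact : IsCompact K
  convex : Convex ℝ K
  nonempty : K.Nonempty

/-- The nearest point map of `K`. -/
noncomputable def nearestPoint {d : ℕ} (K : Set (E d)) (x : E d) : E d :=
  Classical.epsilon fun y => y ∈ K ∧ ∀ z ∈ K, dist x y ≤ dist x z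

namespace IsBody

variable {d : ℕ} {K : Set (E d)}

theorem nearestPoint_spec (hK : IsBody K) (x : E d) :
    nearestPoint K x ∈ K ∧ ∀ z ∈ K, dist x (nearestPoint K x) ≤ dist x z := by
  obtain ⟨y, hy, h⟩ := hK.compact.exists_isMinOn hK.nonempty
    (f := fun z => dist x z) (by fun_prop)
  exact Classical.epsilon_spec (p := fun y => y ∈ K ∧ ∀ z ∈ K, dist x y ≤ dist x z)
    ⟨y, hy, fun z hz => h hz⟩

theorem nearestPoint_mem (hK : IsBody K) (x : E d) : nearestPoint K x ∈ K :=
  (hK.nearestPoint_spec x).1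

theorem inner_le_zero_of_forall_dist_le (hK : Convex ℝ K) {x y : E d} (hy : y ∈ K)
    (h : ∀ z ∈ K, dist x y ≤ dist x z) : ∀ z ∈ K, inner ℝ (x - y) (z - y) ≤ 0 := by
  have hne : Nonempty K := ⟨⟨y, hy⟩⟩
  refine (norm_eq_iInf_iff_real_inner_le_zero hK hy).1 (le_antisymm ?_ ?_)
  · exact le_ciInf fun w => by simpa [dist_eq_norm] using h w w.2
  · exact ciInf_le ⟨0, by rintro _ ⟨w, rfl⟩; positivity⟩ (⟨y, hy⟩ : K)

theorem inner_nearestPoint_le (hK : IsBody K) (x : E d) {z : E d} (hz : z ∈ K) :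
    inner ℝ (x - nearestPoint K x) (z - nearestPoint K x) ≤ 0 :=
  inner_le_zero_of_forall_dist_le hK.convex (hK.nearestPoint_mem x) (hK.nearestPoint_spec x).2 z hz

theorem nearestPoint_eq_of_inner (hK : IsBody K) {x y : E d} (hy : y ∈ K)
    (h : ∀ z ∈ K, inner ℝ (x - y) (z - y) ≤ 0) : nearestPoint K x = y := by
  have h1 := h _ (hK.nearestPoint_mem x)
  have h2 := hK.inner_nearestPoint_le x hy
  set p := nearestPoint K x
  have h3 : inner ℝ (p - y) (p - y) ≤ 0 := by
    have : inner ℝ (p - y) (p - y) = inner ℝ (x - y) (p - y) + inner ℝ (x - p) (y - p) := by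
      simp only [inner_sub_left, inner_sub_right]
      rw [real_inner_comm y p]; ring
    linarith
  rw [real_inner_self_eq_norm_sq] at h3
  exact sub_eq_zero.1 (norm_eq_zero.1 (by nlinarith [norm_nonneg (p - y)]))

theorem nearestPoint_eq (hK : IsBody K) {x y : E d} (hy : y ∈ K)
    (h : ∀ z ∈ K, dist x y ≤ dist x z) : nearestPoint K x = y :=
  hK.nearestPoint_eq_of_inner hy (inner_le_zero_of_forall_dist_le hK.convex hy h)

theorem mem_localParallelSet (hK : IsBody K) {ε : ℝ} {B : Set (E d)} {x : E d} :
    x ∈ localParallelSet ε K B ↔ nearestPoint K x ∈ B ∧ dist x (nearestPoint K x) ≤ ε := by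
  constructor
  · rintro ⟨y, ⟨hy, hB⟩, h, hε⟩
    rw [hK.nearestPoint_eq hy h]
    exact ⟨hB, hε⟩
  · rintro ⟨hB, hε⟩
    exact ⟨_, ⟨hK.nearestPoint_mem x, hB⟩, (hK.nearestPoint_spec x).2, hε⟩

theorem infDist_eq (hK : IsBody K) (x : E d) :
    Metric.infDist x K = dist x (nearestPoint K x) :=
  le_antisymm (Metric.infDist_le_dist_of_mem (hK.nearestPoint_mem x))
    ((Metric.le_infDist hK.nonempty).2 fun {_} hz => (hK.nearestPoint_spec x).2 _ hz)

theorem nearestPoint_of_mem (hK : IsBody K) {x : E d} (hx : x ∈ K) : nearestPoint K x = x :=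
  hK.nearestPoint_eq hx fun z _ => by simp

/-- Firm nonexpansiveness of the nearest point map. -/
theorem norm_sq_le_inner (hK : IsBody K) (x y : E d) :
    ‖nearestPoint K x - nearestPoint K y‖ ^ 2 ≤
      inner ℝ (nearestPoint K x - nearestPoint K y) (x - y) := by
  have h1 := hK.inner_nearestPoint_le x (hK.nearestPoint_mem y)
  have h2 := hK.inner_nearestPoint_le y (hK.nearestPoint_mem x)
  set p := nearestPoint K x
  set q := nearestPoint K y
  have : inner ℝ (p - q) (x - y) - ‖p - q‖ ^ 2 =
      - inner ℝ (x - p) (q - p) - inner ℝ (y - q) (p - q) := by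
    rw [← real_inner_self_eq_norm_sq]
    simp only [inner_sub_left, inner_sub_right]
    rw [real_inner_comm p q, real_inner_comm x p, real_inner_comm x q, real_inner_comm y p,
      real_inner_comm y q]; ring
  linarith

theorem norm_sub_le (hK : IsBody K) (x y : E d) :
    ‖nearestPoint K x - nearestPoint K y‖ ≤ ‖x - y‖ := by
  have h := (hK.norm_sq_le_inner x y).trans (real_inner_le_norm _ _)
  by_contra! hlt
  nlinarith [norm_nonneg (x - y), norm_nonneg (nearestPoint K x - nearestPoint K y)]

theorem lipschitz (hK : IsBody K) : LipschitzWith 1 (nearestPoint K) :=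
  LipschitzWith.of_dist_le_mul fun x y => by simpa [dist_eq_norm] using hK.norm_sub_le x y

/-- The variational inequality is homogeneous in `x - p(x)`, so a whole normal ray has the same
nearest point. -/
theorem nearestPoint_add_smul (hK : IsBody K) (x : E d) {s : ℝ} (hs : 0 ≤ s) :
    nearestPoint K (nearestPoint K x + s • (x - nearestPoint K x)) = nearestPoint K x := by
  refine hK.nearestPoint_eq_of_inner (hK.nearestPoint_mem x) fun z hz => ?_
  rw [add_sub_cancel_left, inner_smul_left]
  exact mul_nonpos_of_nonneg_of_nonpos hs (hK.inner_nearestPoint_le x hz)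

/-- The nearest point map is the gradient of a convex function. -/
theorem hasFDerivAt_potential (hK : IsBody K) (x : E d) :
    HasFDerivAt (fun y => inner ℝ y (nearestPoint K y) - ‖nearestPoint K y‖ ^ 2 / 2)
      (innerSL ℝ (nearestPoint K x)) x := by
  -- The potential is the supremum of `⟨a, y⟩ - ‖y‖² / 2` over `y ∈ K`, attained at the nearest
  -- point. Using it in both directions bounds the linearization error by `‖y - x‖²`.
  have key : ∀ a b : E d, inner ℝ a (nearestPoint K b) - ‖nearestPoint K b‖ ^ 2 / 2 ≤
      inner ℝ a (nearestPoint K a) - ‖nearestPoint K a‖ ^ 2 / 2 := by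
    intro a b
    have h := (hK.nearestPoint_spec a).2 _ (hK.nearestPoint_mem b)
    rw [dist_eq_norm, dist_eq_norm] at h
    have h2 := pow_le_pow_left₀ (norm_nonneg _) h 2
    rw [norm_sub_sq_real, norm_sub_sq_real] at h2
    linarith
  rw [hasFDerivAt_iff_isLittleO]
  refine Asymptotics.IsBigO.trans_isLittleO (g := fun y => ‖y - x‖ ^ 2) ?_ ?_
  · refine Asymptotics.IsBigO.of_bound 1 (Eventually.of_forall fun y => ?_)
    have h1 := key y x
    have h2 := key x y
    have h3 := real_inner_le_norm (nearestPoint K y - nearestPoint K x) (y - x)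
    have h4 : ‖nearestPoint K y - nearestPoint K x‖ * ‖y - x‖ ≤ ‖y - x‖ ^ 2 := by
      rw [sq]; exact mul_le_mul_of_nonneg_right (hK.norm_sub_le y x) (norm_nonneg _)
    rw [Real.norm_of_nonneg (by positivity : (0:ℝ) ≤ ‖y - x‖ ^ 2), one_mul, innerSL_apply_apply,
      Real.norm_eq_abs, abs_le]
    simp only [inner_sub_left, inner_sub_right] at *
    rw [real_inner_comm y (nearestPoint K x), real_inner_comm x (nearestPoint K x),
      real_inner_comm y (nearestPoint K y), real_inner_comm x (nearestPoint K y)] at *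
    have := sq_nonneg ‖y - x‖
    constructor <;> linarith
  · have : Tendsto (fun y : E d => ‖y - x‖) (𝓝 x) (𝓝 0) := by
      have : Continuous fun y : E d => ‖y - x‖ := by fun_prop
      simpa using this.tendsto x
    have h2 : (fun y : E d => ‖y - x‖ * ‖y - x‖) =o[𝓝 x] fun y => 1 * ‖y - x‖ :=
      ((Asymptotics.isLittleO_one_iff ℝ).2 this).mul_isBigO (Asymptotics.isBigO_refl _ _)
    simpa [sq] using h2.norm_right

/-- `D` is a second derivative of the potential, whose first derivative exists everywhere. -/
theorem fderiv_symmetric (hK : IsBody K) {x : E d} {D : E d →L[ℝ] E d}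
    (hD : HasFDerivAt (nearestPoint K) D x) (v w : E d) :
    inner ℝ (D v) w = inner ℝ v (D w) := by
  have h2 : HasFDerivAt (fun y => innerSL ℝ (nearestPoint K y)) ((innerSL ℝ).comp D) x :=
    (innerSL ℝ (E := E d)).hasFDerivAt.comp x hD
  have := second_derivative_symmetric hK.hasFDerivAt_potential h2 v w
  simp only [ContinuousLinearMap.comp_apply, innerSL_apply_apply] at this
  rw [this, real_inner_comm]

/-- Infinitesimal form of firm nonexpansiveness: divide by `t²` and let `t → 0`. -/
theorem fderiv_norm_sq_le (hK : IsBody K) {x : E d} {D : E d →L[ℝ] E d}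
    (hD : HasFDerivAt (nearestPoint K) D x) (v : E d) : ‖D v‖ ^ 2 ≤ inner ℝ (D v) v := by
  have h := hD.hasLineDerivAt v
  rw [HasLineDerivAt, hasDerivAt_iff_tendsto_slope_zero] at h
  simp only [zero_add, zero_smul, add_zero] at h
  have h1 := (h.norm.pow 2)
  have h2 := h.inner (𝕜 := ℝ) (tendsto_const_nhds (x := v))
  refine le_of_tendsto_of_tendsto h1 h2 ?_
  filter_upwards [self_mem_nhdsWithin] with t ht
  have h3 := hK.norm_sq_le_inner (x + t • v) x
  rw [add_sub_cancel_left, inner_smul_right] at h3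
  rw [norm_smul, mul_pow, inner_smul_left, norm_inv, Real.norm_eq_abs, inv_pow, sq_abs]
  have ht0 : t ≠ 0 := ht
  have h4 : 0 ≤ (t ^ 2)⁻¹ := by positivity
  refine (mul_le_mul_of_nonneg_left h3 h4).trans (le_of_eq ?_)
  simp only [conj_trivial]
  field_simp

/-- The differential of the nearest point map is diagonalizable with eigenvalues in `[0, 1]`. -/
theorem exists_eigenbasis (hK : IsBody K) {x : E d} {D : E d →L[ℝ] E d}
    (hD : HasFDerivAt (nearestPoint K) D x) :
    ∃ (b : OrthonormalBasis (Fin d) ℝ (E d)) (l : Fin d → ℝ),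
      (∀ i, D (b i) = l i • b i) ∧ ∀ i, 0 ≤ l i ∧ l i ≤ 1 := by
  have hsym : (D : E d →ₗ[ℝ] E d).IsSymmetric := fun v w => hK.fderiv_symmetric hD v w
  have hn : Module.finrank ℝ (E d) = d := by simp
  have heig : ∀ i, D (hsym.eigenvectorBasis hn i) =
      hsym.eigenvalues hn i • hsym.eigenvectorBasis hn i := fun i => by
    exact hsym.apply_eigenvectorBasis hn i
  refine ⟨hsym.eigenvectorBasis hn, hsym.eigenvalues hn, heig, fun i => ?_⟩
  -- On a unit eigenvector with eigenvalue `l` this reads `l² ≤ l`.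
  have h := hK.fderiv_norm_sq_le hD (hsym.eigenvectorBasis hn i)
  rw [heig, norm_smul, inner_smul_left, real_inner_self_eq_norm_sq,
    (hsym.eigenvectorBasis hn).norm_eq_one] at h
  simp only [mul_one, Real.norm_eq_abs, sq_abs, conj_trivial, one_pow] at h
  constructor <;> nlinarith

end IsBody

/-! ### The local Steiner formula. -/

theorem det_add_smul_of_eigenbasis {d : ℕ} {D : E d →L[ℝ] E d}
    (b : OrthonormalBasis (Fin d) ℝ (E d)) (l : Fin d → ℝ) (h : ∀ i, D (b i) = l i • b i) (s : ℝ) :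
    (D + s • (ContinuousLinearMap.id ℝ (E d) - D)).det = ∏ i, (l i + s * (1 - l i)) := by
  have : LinearMap.toMatrix b.toBasis b.toBasis
      ((D + s • (ContinuousLinearMap.id ℝ (E d) - D) : E d →L[ℝ] E d) : E d →ₗ[ℝ] E d) =
      Matrix.diagonal fun i => l i + s * (1 - l i) := by
    ext i j
    have : D (b j) + s • (b j - D (b j)) = (l j + s * (1 - l j)) • b j := by
      rw [h]; module
    simp [LinearMap.toMatrix_apply, this, Matrix.diagonal_apply]
    grind
  rw [ContinuousLinearMap.det, ← LinearMap.det_toMatrix b.toBasis, this, Matrix.det_diagonal]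

open Polynomial in
/-- The coefficients of a polynomial of degree at most `n` are linear in its values at
`1, …, n + 1`. -/
theorem coeff_eq_sum_eval {P : ℝ[X]} {n : ℕ} (hP : P.natDegree ≤ n) (m : ℕ) :
    P.coeff m = ∑ i ∈ Finset.range (n + 1), P.eval ((i : ℝ) + 1) *
      (Lagrange.basis (Finset.range (n + 1)) (fun i : ℕ => (i : ℝ) + 1) i).coeff m := by
  have hinj : Set.InjOn (fun i : ℕ => (i : ℝ) + 1) (Finset.range (n + 1)) := by
    intro a _ b _ h
    simpa using h
  have hdeg : P.degree < (Finset.range (n + 1)).card := by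
    rw [Finset.card_range]
    exact (Polynomial.degree_le_of_natDegree_le hP).trans_lt (by exact_mod_cast Nat.lt_succ_self n)
  conv_lhs => rw [Lagrange.eq_interpolate hinj hdeg, Lagrange.interpolate_apply]
  simp

open Polynomial in
theorem integrable_coeff {Ω : Type*} [MeasurableSpace Ω] {μ : Measure Ω} {P : Ω → ℝ[X]} {n : ℕ}
    (hP : ∀ x, (P x).natDegree ≤ n) (hint : ∀ s : ℝ, 0 < s → Integrable (fun x => (P x).eval s) μ)
    (m : ℕ) : Integrable (fun x => (P x).coeff m) μ := by
  have : (fun x => (P x).coeff m) = fun x => ∑ i ∈ Finset.range (n + 1),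
      (P x).eval ((i : ℝ) + 1) *
        (Lagrange.basis (Finset.range (n + 1)) (fun i : ℕ => (i : ℝ) + 1) i).coeff m :=
    funext fun x => coeff_eq_sum_eval (hP x) m
  rw [this]
  exact integrable_finsetSum _ fun i _ => (hint _ (by positivity)).mul_const _

open Polynomial in
theorem exists_polynomial_integral {Ω : Type*} [MeasurableSpace Ω] {μ : Measure Ω} {P : Ω → ℝ[X]}
    {n : ℕ} (hP : ∀ x, (P x).natDegree ≤ n)
    (hint : ∀ s : ℝ, 0 < s → Integrable (fun x => (P x).eval s) μ) :
    ∃ G : ℝ[X], G.natDegree ≤ n ∧ (∀ s, ∫ x, (P x).eval s ∂μ = G.eval s) ∧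
      ∀ m ≤ n, G.coeff m = ∫ x, (P x).coeff m ∂μ := by
  refine ⟨∑ m ∈ Finset.range (n + 1), C (∫ x, (P x).coeff m ∂μ) * X ^ m, ?_, fun s => ?_,
    fun m hm => ?_⟩
  · refine natDegree_sum_le_of_forall_le _ _ fun m hm => ?_
    exact (natDegree_C_mul_X_pow_le _ _).trans (by simpa using Finset.mem_range_succ_iff.1 hm)
  · have : (fun x => (P x).eval s) =
        fun x => ∑ m ∈ Finset.range (n + 1), (P x).coeff m * s ^ m := by
      funext x
      exact eval_eq_sum_range' (Nat.lt_succ_of_le (hP x)) s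
    rw [this, integral_finsetSum _ fun m _ => (integrable_coeff hP hint m).mul_const _]
    simp [eval_finsetSum, integral_mul_const]
  · rw [finsetSum_coeff, Finset.sum_eq_single m (fun j _ hj => by
      rw [coeff_C_mul_X_pow, if_neg hj.symm]) (fun h => absurd (Finset.mem_range_succ_iff.2 hm) h),
      coeff_C_mul_X_pow, if_pos rfl]

/-- Volume and `d`-dimensional Hausdorff measure are constant multiples of each other, and a
Lipschitz map increases the latter by at most a constant factor. -/
theorem volume_image_eq_zero_of_lipschitz {d : ℕ} {f : E d → E d} {C : NNReal}
    (hf : LipschitzWith C f) {s : Set (E d)} (hs : volume s = 0) : volume (f '' s) = 0 := by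
  have hfin : (Module.finrank ℝ (E d) : ℝ) = d := by simp
  have : (Measure.hausdorffMeasure (d : ℝ) : Measure (E d)).IsAddHaarMeasure :=
    hfin ▸ isAddHaarMeasure_hausdorffMeasure
  have h1 := Measure.isAddLeftInvariant_eq_smul (volume : Measure (E d))
    (Measure.hausdorffMeasure (d : ℝ))
  have h2 := Measure.isAddLeftInvariant_eq_smul (Measure.hausdorffMeasure (d : ℝ) : Measure (E d))
    volume
  have h3 : Measure.hausdorffMeasure (d : ℝ) s = 0 := by
    rw [h2]; simp [hs]
  have h4 := hf.hausdorffMeasure_image_le (d := (d : ℝ)) (by positivity) s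
  rw [h3, mul_zero, nonpos_iff_eq_zero] at h4
  rw [h1]; simp [h4]

/-- `M` is invariant under sliding points along the rays issuing from their nearest points. -/
def IsRayInvariant {d : ℕ} (K M : Set (E d)) : Prop :=
  ∀ x ∈ M, ∀ s : ℝ, 0 < s → nearestPoint K x + s • (x - nearestPoint K x) ∈ M

/-- The points of `M` whose distance to `K` is positive and at most `R`. -/
def shell {d : ℕ} (K M : Set (E d)) (R : ℝ) : Set (E d) :=
  M ∩ {x | 0 < dist x (nearestPoint K x) ∧ dist x (nearestPoint K x) ≤ R}

namespace IsBody

variable {d : ℕ} {K : Set (E d)}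

theorem measurableSet_shell (hK : IsBody K) {M : Set (E d)} (hM : MeasurableSet M) (R : ℝ) :
    MeasurableSet (shell K M R) := by
  have hc : Continuous fun x => dist x (nearestPoint K x) :=
    continuous_id.dist hK.lipschitz.continuous
  exact hM.inter ((measurableSet_lt measurable_const hc.measurable).inter
    (measurableSet_le hc.measurable measurable_const))

theorem dist_le_iff_mem_cthickening (hK : IsBody K) {R : ℝ} (hR : 0 ≤ R) {x : E d} :
    dist x (nearestPoint K x) ≤ R ↔ x ∈ Metric.cthickening R K := by
  rw [← hK.infDist_eq, Metric.mem_cthickening_iff, Metric.infDist,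
    ENNReal.le_ofReal_iff_toReal_le (Metric.infEDist_ne_top hK.nonempty) hR]

theorem volume_shell_lt_top (hK : IsBody K) (M : Set (E d)) (R : ℝ) :
    volume (shell K M R) < ⊤ := by
  refine (measure_mono (t := Metric.cthickening (max R 0) K) fun x hx => ?_).trans_lt
    (hK.compact.cthickening (r := max R 0)).measure_lt_top
  exact (hK.dist_le_iff_mem_cthickening (le_max_right _ _)).1 (hx.2.2.trans (le_max_left _ _))

/-- Sliding by `s` keeps the nearest point and multiplies the distance by `s`, so sliding by `s⁻¹`
inverts it. -/
theorem image_shell (hK : IsBody K) {M : Set (E d)} (hM : IsRayInvariant K M) {R s : ℝ}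
    (hs : 0 < s) :
    (fun x => nearestPoint K x + s • (x - nearestPoint K x)) '' shell K M R =
      shell K M (s * R) := by
  have hd : ∀ x (t : ℝ), 0 < t →
      dist (nearestPoint K x + t • (x - nearestPoint K x)) (nearestPoint K x) =
        t * dist x (nearestPoint K x) := fun x t ht => by
    rw [dist_eq_norm, add_sub_cancel_left, norm_smul, Real.norm_of_nonneg ht.le, dist_eq_norm]
  ext y
  constructor
  · rintro ⟨x, ⟨hx, h0, hR⟩, rfl⟩
    refine ⟨hM x hx s hs, ?_⟩
    simp only [mem_ofPred_eq]
    rw [hK.nearestPoint_add_smul x hs.le, hd x s hs]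
    exact ⟨by positivity, by gcongr⟩
  · rintro ⟨hy, h0, hR⟩
    have hs' : 0 < s⁻¹ := by positivity
    refine ⟨nearestPoint K y + s⁻¹ • (y - nearestPoint K y), ⟨hM y hy _ hs', ?_⟩, ?_⟩
    · simp only [mem_ofPred_eq]
      rw [hK.nearestPoint_add_smul y hs'.le, hd y _ hs']
      refine ⟨by positivity, ?_⟩
      rw [inv_mul_le_iff₀ hs]; exact hR
    · simp only
      rw [hK.nearestPoint_add_smul y hs'.le, add_sub_cancel_left, smul_smul,
        mul_inv_cancel₀ hs.ne', one_smul, add_sub_cancel]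

theorem injective_slide (hK : IsBody K) {s : ℝ} (hs : 0 < s) :
    Function.Injective (fun x => nearestPoint K x + s • (x - nearestPoint K x)) := by
  intro x y h
  simp only at h
  have hp : nearestPoint K x = nearestPoint K y := by
    rw [← hK.nearestPoint_add_smul x hs.le, h, hK.nearestPoint_add_smul y hs.le]
  rw [hp] at h
  have := smul_right_injective (E d) hs.ne' (add_left_cancel h)
  exact sub_left_injective this

/-- Change of variables for the injective slide. By Rademacher it is differentiable off a null set,
whose image is null because the slide is Lipschitz. -/
theorem lintegral_det_eq_volume_shell (hK : IsBody K) {M : Set (E d)} (hMm : MeasurableSet M)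
    (hM : IsRayInvariant K M) {R s : ℝ} (hs : 0 < s) :
    ∫⁻ x in shell K M R, ENNReal.ofReal |(fderiv ℝ (nearestPoint K) x +
      s • (ContinuousLinearMap.id ℝ (E d) - fderiv ℝ (nearestPoint K) x)).det| =
      volume (shell K M (s * R)) := by
  set p := nearestPoint K
  set T : E d → E d := fun x => p x + s • (x - p x) with hT
  set S := shell K M R
  set Df := {x | DifferentiableAt ℝ p x}
  have hDf : MeasurableSet Df := measurableSet_of_differentiableAt ℝ p
  have hS : MeasurableSet S := hK.measurableSet_shell hMm R
  have hnull : volume Dfᶜ = 0 := hK.lipschitz.ae_differentiableAt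
  have hTL : LipschitzWith (1 + ‖s‖₊ * (1 + 1)) T :=
    hK.lipschitz.add (by
      have := (LipschitzWith.id (α := E d)).sub hK.lipschitz
      exact (lipschitzWith_smul s).comp this)
  have hderiv : ∀ x ∈ S ∩ Df, HasFDerivWithinAt T
      (fderiv ℝ p x + s • (ContinuousLinearMap.id ℝ (E d) - fderiv ℝ p x)) (S ∩ Df) x := by
    intro x hx
    have h := hx.2.hasFDerivAt
    exact (h.add (((hasFDerivAt_id x).sub h).const_smul s)).hasFDerivWithinAt
  have h1 := lintegral_abs_det_fderiv_eq_addHaar_image volume (hS.inter hDf) hderiv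
    (hK.injective_slide hs).injOn
  have h2 : ((S ∩ Df : Set (E d)) : Set (E d)) =ᵐ[volume] S :=
    inter_ae_eq_left_of_ae_eq_univ (ae_eq_univ.2 hnull)
  rw [setLIntegral_congr h2] at h1
  rw [h1, ← hK.image_shell hM hs]
  refine le_antisymm (measure_mono (image_mono inter_subset_left)) ?_
  calc volume (T '' S) ≤ volume (T '' (S ∩ Df) ∪ T '' Dfᶜ) := by
        refine measure_mono ?_
        rw [← image_union]
        refine image_mono fun x hx => ?_
        by_cases h : x ∈ Df
        · exact Or.inl ⟨hx, h⟩
        · exact Or.inr h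
    _ ≤ volume (T '' (S ∩ Df)) + volume (T '' Dfᶜ) := measure_union_le _ _
    _ = volume (T '' (S ∩ Df)) := by rw [volume_image_eq_zero_of_lipschitz hTL hnull, add_zero]

open Polynomial in
theorem exists_det_polynomial (hK : IsBody K) (x : E d) :
    ∃ P : ℝ[X], P.natDegree ≤ d ∧ (∀ m, 0 ≤ P.coeff m) ∧
      (DifferentiableAt ℝ (nearestPoint K) x →
        (∀ s : ℝ, P.eval s = (fderiv ℝ (nearestPoint K) x +
          s • (ContinuousLinearMap.id ℝ (E d) - fderiv ℝ (nearestPoint K) x)).det) ∧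
        ∀ k ≤ d, k ≤ Module.finrank ℝ (LinearMap.range (fderiv ℝ (nearestPoint K) x).toLinearMap) →
          d - k ≤ Module.finrank ℝ (LinearMap.range
            (ContinuousLinearMap.id ℝ (E d) - fderiv ℝ (nearestPoint K) x).toLinearMap) →
          0 < P.coeff (d - k)) := by
  classical
  by_cases hdiff : DifferentiableAt ℝ (nearestPoint K) x
  swap
  -- The zero polynomial serves at the null set of points where there is no differential.
  · exact ⟨0, by simp, by simp, fun h => absurd h hdiff⟩
  obtain ⟨b, l, hb, hl⟩ := hK.exists_eigenbasis hdiff.hasFDerivAt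
  set D := fderiv ℝ (nearestPoint K) x
  have hcoeff : ∀ m, (∏ i, (C (1 - l i) * X + C (l i))).coeff m =
      ∑ t : Finset (Fin d), if m = t.card then (∏ i ∈ t, (1 - l i)) * ∏ i ∈ tᶜ, l i else 0 := by
    intro m
    rw [Finset.prod_add, finsetSum_coeff, Finset.powerset_univ]
    refine Finset.sum_congr rfl fun t _ => ?_
    rw [Finset.prod_mul_distrib, Finset.prod_const, ← Finset.compl_eq_univ_sdiff,
      ← map_prod, ← map_prod, mul_right_comm, ← C_mul, coeff_C_mul_X_pow]
  have hnn : ∀ t : Finset (Fin d), 0 ≤ (∏ i ∈ t, (1 - l i)) * ∏ i ∈ tᶜ, l i := fun t =>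
    mul_nonneg (Finset.prod_nonneg fun i _ => by linarith [(hl i).2])
      (Finset.prod_nonneg fun i _ => (hl i).1)
  have hrank : ∀ (F : E d →ₗ[ℝ] E d) (m : Fin d → ℝ), (∀ i, F (b i) = m i • b i) →
      Module.finrank ℝ (LinearMap.range F) ≤ (Finset.univ.filter fun i => m i ≠ 0).card := by
    intro F m hm
    have hle : LinearMap.range F ≤
        Submodule.span ℝ (((Finset.univ.filter fun i => m i ≠ 0).image b : Finset (E d)) :
          Set (E d)) := by
      rintro _ ⟨v, rfl⟩
      rw [← b.sum_repr v, map_sum]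
      refine Submodule.sum_mem _ fun i _ => ?_
      rw [map_smul, hm]
      by_cases h0 : m i = 0
      · simp [h0]
      · refine Submodule.smul_mem _ _ (Submodule.smul_mem _ _ (Submodule.subset_span ?_))
        simp only [Finset.coe_image]
        exact ⟨i, by simpa using h0, rfl⟩
    exact (Submodule.finrank_mono hle).trans
      ((finrank_span_finset_le_card _).trans Finset.card_image_le)
  refine ⟨∏ i, (C (1 - l i) * X + C (l i)), ?_, fun m => ?_, fun _ => ⟨fun s => ?_, ?_⟩⟩
  · refine (natDegree_prod_le _ _).trans ((Finset.sum_le_card_nsmul _ _ 1 fun i _ => ?_).trans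
      (by simp))
    exact natDegree_linear_le
  · rw [hcoeff]
    exact Finset.sum_nonneg fun t _ => by split_ifs; exacts [hnn t, le_rfl]
  · rw [det_add_smul_of_eigenbasis b l hb, eval_prod]
    refine Finset.prod_congr rfl fun i _ => ?_
    simp only [eval_add, eval_mul, eval_C, eval_X]; ring
  · intro k hk h1 h2
    have h1' := h1.trans (hrank D.toLinearMap l hb)
    have h2' := h2.trans (hrank (ContinuousLinearMap.id ℝ (E d) - D).toLinearMap (fun i => 1 - l i)
      fun i => by
        change b i - D (b i) = _
        rw [hb]; module)
    -- The term of `t` is positive when `t` contains every index with `l i = 0` and none with `l i =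
    -- 1`. The rank bounds say that there are at most `d - k` of the former and at least `d - k`
    -- indices with `l i ≠ 1`, so such a `t` of size `d - k` exists.
    obtain ⟨t, ht1, ht2, ht3⟩ := Finset.exists_subsuperset_card_eq
      (s := Finset.univ.filter fun i => l i = 0) (t := Finset.univ.filter fun i => 1 - l i ≠ 0)
      (n := d - k) (fun i hi => by simp_all) (by
        have := Finset.card_filter_add_card_filter_not (s := (Finset.univ : Finset (Fin d)))
          (fun i => l i = 0)
        rw [Finset.card_univ, Fintype.card_fin] at this
        have h1'' : k ≤ (Finset.univ.filter fun i => ¬ l i = 0).card := h1'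
        omega) h2'
    rw [hcoeff]
    refine Finset.sum_pos' (fun t _ => by split_ifs; exacts [hnn t, le_rfl])
      ⟨t, Finset.mem_univ _, ?_⟩
    rw [if_pos ht3.symm]
    refine mul_pos (Finset.prod_pos fun i hi => ?_) (Finset.prod_pos fun i hi => ?_)
    · have := (Finset.mem_filter.1 (ht2 hi)).2
      exact lt_of_le_of_ne (by linarith [(hl i).2]) this.symm
    · refine lt_of_le_of_ne (hl i).1 fun h => ?_
      exact (Finset.mem_compl.1 hi) (ht1 (by simp [← h]))

open Polynomial in
/-- The local Steiner formula: the volume of a shell is a polynomial in its width. -/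
theorem exists_shell_polynomial (hK : IsBody K) {M : Set (E d)} (hMm : MeasurableSet M)
    (hM : IsRayInvariant K M) {R : ℝ} (hR : 0 < R) :
    ∃ G : ℝ[X], G.natDegree ≤ d ∧ (∀ s : ℝ, 0 < s → (volume (shell K M s)).toReal = G.eval s) ∧
      ∀ k ≤ d, volume (shell K M R ∩ {x | DifferentiableAt ℝ (nearestPoint K) x ∧
          k ≤ Module.finrank ℝ (LinearMap.range (fderiv ℝ (nearestPoint K) x).toLinearMap) ∧
          d - k ≤ Module.finrank ℝ (LinearMap.range
            (ContinuousLinearMap.id ℝ (E d) - fderiv ℝ (nearestPoint K) x).toLinearMap)}) ≠ 0 →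
        0 < G.coeff (d - k) := by
  choose P hPdeg hPnn hP using hK.exists_det_polynomial
  set μ := volume.restrict (shell K M R)
  set Dt : ℝ → E d → ℝ := fun s x => (fderiv ℝ (nearestPoint K) x +
      s • (ContinuousLinearMap.id ℝ (E d) - fderiv ℝ (nearestPoint K) x)).det with hDt
  have hae : ∀ s : ℝ, (fun x => (P x).eval s) =ᵐ[μ] Dt s := fun s => by
    refine ae_restrict_of_ae ?_
    filter_upwards [hK.lipschitz.ae_differentiableAt] with x hx
    exact (hP x hx).1 s
  have hmeas : ∀ s, Measurable (Dt s) := fun s => by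
    refine ContinuousLinearMap.continuous_det.measurable.comp ?_
    have := measurable_fderiv ℝ (nearestPoint K)
    exact this.add ((measurable_const.sub this).const_smul s)
  have hnn : ∀ s : ℝ, 0 < s → ∀ x, 0 ≤ (P x).eval s := fun s hs x => by
    rw [eval_eq_sum_range]
    exact Finset.sum_nonneg fun i _ => mul_nonneg (hPnn x i) (by positivity)
  have hlint : ∀ s : ℝ, 0 < s → ∫⁻ x, ENNReal.ofReal ((P x).eval s) ∂μ =
      volume (shell K M (s * R)) := fun s hs => by
    rw [← hK.lintegral_det_eq_volume_shell hMm hM hs]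
    refine lintegral_congr_ae ?_
    filter_upwards [hae s] with x hx
    rw [← abs_of_nonneg (hnn s hs x), hx]
  have hasm : ∀ s, AEStronglyMeasurable (fun x => (P x).eval s) μ := fun s =>
    ((hmeas s).aestronglyMeasurable).congr (hae s).symm
  have hint : ∀ s : ℝ, 0 < s → Integrable (fun x => (P x).eval s) μ := fun s hs => by
    refine ⟨hasm s, ?_⟩
    rw [hasFiniteIntegral_iff_ofReal (Eventually.of_forall (hnn s hs)), hlint s hs]
    exact hK.volume_shell_lt_top M _
  obtain ⟨G, hG, hGe, hGc⟩ := exists_polynomial_integral hPdeg hint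
  -- `G` is a polynomial in the sliding factor relative to `R`; the width is `R` times that factor.
  refine ⟨G.comp (C R⁻¹ * X), ?_, fun s hs => ?_, fun k hk hpos => ?_⟩
  · refine natDegree_comp_le.trans ?_
    calc _ ≤ d * 1 := Nat.mul_le_mul hG ((natDegree_C_mul_le _ _).trans natDegree_X_le)
      _ = d := mul_one d
  · have hs' : 0 < R⁻¹ * s := by positivity
    rw [eval_comp, eval_mul, eval_C, eval_X, ← hGe,
      integral_eq_lintegral_of_nonneg_ae (Eventually.of_forall (hnn _ hs')) (hasm _), hlint _ hs']
    congr 3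
    field_simp
  · rw [comp_C_mul_X_coeff, hGc _ (Nat.sub_le _ _)]
    refine mul_pos ?_ (by positivity)
    rw [integral_pos_iff_support_of_nonneg (fun x => hPnn x _) (integrable_coeff hPdeg hint _)]
    refine lt_of_lt_of_le (pos_iff_ne_zero.2 hpos) ?_
    rw [← Measure.restrict_eq_self volume inter_subset_left]
    refine measure_mono fun x hx => ?_
    exact ((hP x hx.2.1).2 k hk hx.2.2.1 hx.2.2.2).ne'

end IsBody

/-! ### Curvature measures of convex sets as Steiner coefficients. -/

theorem unitBallVolume_pos (j : ℕ) : 0 < unitBallVolume j :=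
  ENNReal.toReal_pos (Metric.measure_closedBall_pos volume _ one_pos).ne'
    (isCompact_closedBall _ _).measure_lt_top.ne

theorem localParallelSet_subset {d : ℕ} {ε : ℝ} {K B : Set (E d)} :
    localParallelSet ε K B ⊆ Metric.cthickening ε K := by
  rintro x ⟨y, ⟨hy, -⟩, -, h⟩
  exact Metric.mem_cthickening_of_dist_le _ _ _ _ hy h

theorem localParallelSet_eq_empty {d : ℕ} {ε : ℝ} {K B : Set (E d)} (h : K ∩ B = ∅) :
    localParallelSet ε K B = ∅ := by
  simp [localParallelSet, h]

theorem isBody_or_eq_empty {d : ℕ} {K : Set (E d)} (hK : IsCompact K ∧ Convex ℝ K) :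
    IsBody K ∨ K = ∅ := by
  rcases K.eq_empty_or_nonempty with h | h
  · exact Or.inr h
  · exact Or.inl ⟨hK.1, hK.2, h⟩

theorem IsBody.measurableSet_localParallelSet {d : ℕ} {K : Set (E d)} (hK : IsBody K) (ε : ℝ)
    {B : Set (E d)} (hB : MeasurableSet B) : MeasurableSet (localParallelSet ε K B) := by
  have hc : Continuous fun x => dist x (nearestPoint K x) :=
    continuous_id.dist hK.lipschitz.continuous
  have : localParallelSet ε K B =
      nearestPoint K ⁻¹' B ∩ {x | dist x (nearestPoint K x) ≤ ε} := by
    ext x; simp [hK.mem_localParallelSet]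
  rw [this]
  exact (hK.lipschitz.continuous.measurable hB).inter
    (measurableSet_le hc.measurable measurable_const)

theorem measurableSet_localParallelSet {d : ℕ} {K : Set (E d)} (hK : IsCompact K ∧ Convex ℝ K)
    (ε : ℝ) {B : Set (E d)} (hB : MeasurableSet B) : MeasurableSet (localParallelSet ε K B) := by
  rcases isBody_or_eq_empty hK with h | rfl
  · exact h.measurableSet_localParallelSet ε hB
  · simp [localParallelSet_eq_empty]

theorem volume_localParallelSet_lt_top {d : ℕ} {K : Set (E d)} (hK : IsCompact K) (ε : ℝ)
    (B : Set (E d)) : volume (localParallelSet ε K B) < ⊤ :=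
  (measure_mono localParallelSet_subset).trans_lt hK.cthickening.measure_lt_top

-- Points of `K` contribute the constant term, the volume of `K ∩ B`; the remaining points form a
-- shell over the ray-invariant preimage of `B`.
open Polynomial in
theorem exists_steiner_polynomial {d : ℕ} {K B : Set (E d)} (hK : IsCompact K ∧ Convex ℝ K)
    (hB : MeasurableSet B) : ∃ P : ℝ[X], P.natDegree ≤ d ∧
      ∀ ε : ℝ, 0 < ε → (volume (localParallelSet ε K B)).toReal = P.eval ε := by
  rcases isBody_or_eq_empty hK with hK | rfl
  swap
  · exact ⟨0, by simp, fun ε _ => by simp [localParallelSet_eq_empty]⟩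
  have hm : MeasurableSet (nearestPoint K ⁻¹' B) := hK.lipschitz.continuous.measurable hB
  have hM : IsRayInvariant K (nearestPoint K ⁻¹' B) := fun x hx s hs => by
    rw [mem_preimage, hK.nearestPoint_add_smul x hs.le]; exact hx
  obtain ⟨G, hG, hGe, -⟩ := hK.exists_shell_polynomial hm hM one_pos
  refine ⟨C (volume (K ∩ B)).toReal + G, ?_, fun ε hε => ?_⟩
  · exact (natDegree_add_le _ _).trans (by simp [hG])
  · have hu : localParallelSet ε K B = (K ∩ B) ∪ shell K (nearestPoint K ⁻¹' B) ε := by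
      ext x
      rw [hK.mem_localParallelSet]
      constructor
      · rintro ⟨h1, h2⟩
        rcases eq_or_ne x (nearestPoint K x) with h | h
        · exact Or.inl ⟨h ▸ hK.nearestPoint_mem x, by rwa [h]⟩
        · exact Or.inr ⟨h1, dist_pos.2 h, h2⟩
      · rintro (⟨h1, h2⟩ | ⟨h1, -, h2⟩)
        · rw [hK.nearestPoint_of_mem h1]; simp [h2, hε.le]
        · exact ⟨h1, h2⟩
    have hdisj : Disjoint (K ∩ B) (shell K (nearestPoint K ⁻¹' B) ε) := by
      rw [Set.disjoint_left]
      rintro x ⟨h1, -⟩ ⟨-, h2, -⟩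
      rw [hK.nearestPoint_of_mem h1] at h2
      simp at h2
    rw [hu, measure_union hdisj (hK.measurableSet_shell hm ε), ENNReal.toReal_add
      ((measure_mono inter_subset_left).trans_lt hK.compact.measure_lt_top).ne
      (hK.volume_shell_lt_top _ _).ne, hGe ε hε]
    simp

open Polynomial in
theorem eq_of_eval_eq_of_pos {P Q : ℝ[X]} (h : ∀ ε : ℝ, 0 < ε → P.eval ε = Q.eval ε) : P = Q :=
  eq_of_infinite_eval_eq P Q ((Ioi_infinite (0 : ℝ)).mono fun ε hε => h ε hε)

open Polynomial in
theorem IsSteinerCoeff.eq_coeff {d : ℕ} {K B : Set (E d)} {c : Fin (d + 1) → ℝ}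
    (hc : IsSteinerCoeff K B c) {P : ℝ[X]}
    (hP : ∀ ε : ℝ, 0 < ε → (volume (localParallelSet ε K B)).toReal = P.eval ε)
    (j : Fin (d + 1)) : c j = P.coeff (d - j) / unitBallVolume (d - j) := by
  have hPQ : P = ∑ i : Fin (d + 1), C (unitBallVolume (d - i) * c i) * X ^ (d - (i : ℕ)) := by
    refine eq_of_eval_eq_of_pos fun ε hε => ?_
    rw [← hP ε hε, hc ε hε, eval_finsetSum]
    refine Finset.sum_congr rfl fun i _ => ?_
    simp only [eval_mul, eval_C, eval_pow, eval_X]; ring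
  rw [hPQ, finsetSum_coeff, Finset.sum_eq_single j, coeff_C_mul_X_pow, if_pos rfl,
    mul_div_cancel_left₀ _ (unitBallVolume_pos _).ne']
  · intro i _ hij
    rw [coeff_C_mul_X_pow, if_neg]
    intro h
    exact hij (Fin.ext (by have := i.2; have := j.2; omega))
  · simp

-- Existence and uniqueness of the coefficients: after this, neither the choice nor the default
-- value in `convexCurvature` matters.
open Polynomial in
theorem convexCurvature_eq_coeff {d : ℕ} {K B : Set (E d)} {P : ℝ[X]} (hdeg : P.natDegree ≤ d)
    (hP : ∀ ε : ℝ, 0 < ε → (volume (localParallelSet ε K B)).toReal = P.eval ε)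
    (j : Fin (d + 1)) : convexCurvature j K B = P.coeff (d - j) / unitBallVolume (d - j) := by
  have h : ∃ c : Fin (d + 1) → ℝ, IsSteinerCoeff K B c := by
    refine ⟨fun j => P.coeff (d - j) / unitBallVolume (d - j), fun ε hε => ?_⟩
    rw [hP ε hε, eval_eq_sum_range' (Nat.lt_succ_of_le hdeg), ← Finset.sum_range_reflect,
      Finset.sum_range]
    refine Finset.sum_congr rfl fun i _ => ?_
    have := (unitBallVolume_pos (d - i)).ne'
    rw [show d + 1 - 1 - (i : ℕ) = d - i by omega]
    field_simp
  rw [convexCurvature, dif_pos h]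
  exact h.choose_spec.eq_coeff hP j

theorem convexCurvature_eq_zero {d : ℕ} {K B : Set (E d)} (h : K ∩ B = ∅) (j : Fin (d + 1)) :
    convexCurvature j K B = 0 := by
  rw [convexCurvature_eq_coeff (P := 0) (by simp) (fun ε _ => by
    simp [localParallelSet_eq_empty h]) j]
  simp

/-- The curvature measures of convex sets contained in a fixed compact set are uniformly bounded. -/
theorem exists_convexCurvature_bound {d : ℕ} (j : Fin (d + 1)) {L : Set (E d)} (hL : IsCompact L) :
    ∃ c : ℝ, 0 ≤ c ∧ ∀ K B : Set (E d), IsCompact K ∧ Convex ℝ K → K ⊆ L → MeasurableSet B →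
      |convexCurvature j K B| ≤ c := by
  set b : ℕ → ℝ := fun i => (Lagrange.basis (Finset.range (d + 1))
    (fun i : ℕ => (i : ℝ) + 1) i).coeff (d - j)
  set V : ℕ → ℝ := fun i => (volume (Metric.cthickening ((i : ℝ) + 1) L)).toReal
  refine ⟨(∑ i ∈ Finset.range (d + 1), V i * |b i|) / unitBallVolume (d - j), ?_, ?_⟩
  · exact div_nonneg (Finset.sum_nonneg fun i _ => mul_nonneg ENNReal.toReal_nonneg (abs_nonneg _))
      (unitBallVolume_pos _).le
  · intro K B hK hKL hB
    obtain ⟨P, hP, hPe⟩ := exists_steiner_polynomial hK hB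
    rw [convexCurvature_eq_coeff hP hPe, abs_div, abs_of_pos (unitBallVolume_pos _)]
    refine div_le_div_of_nonneg_right ?_ (unitBallVolume_pos _).le
    -- The coefficient is a fixed combination of the values at `1, …, d + 1`, each at most the
    -- volume of a parallel set of `L`.
    rw [coeff_eq_sum_eval hP]
    refine (Finset.abs_sum_le_sum_abs _ _).trans (Finset.sum_le_sum fun i _ => ?_)
    rw [abs_mul, ← hPe _ (by positivity)]
    refine mul_le_mul_of_nonneg_right ?_ (abs_nonneg _)
    rw [abs_of_nonneg ENNReal.toReal_nonneg]
    refine ENNReal.toReal_mono hL.cthickening.measure_lt_top.ne (measure_mono ?_)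
    exact localParallelSet_subset.trans (Metric.cthickening_subset_of_subset _ hKL)

/-! ### Independence of the convex representation. -/

open Classical in
theorem sum_mul_convexCurvature_eq_zero {d : ℕ} {ι : Type*} (s : Finset ι) (a : ι → ℝ)
    (K : ι → Set (E d)) {B : Set (E d)} (hK : ∀ i ∈ s, IsCompact (K i) ∧ Convex ℝ (K i))
    (hB : MeasurableSet B)
    (h : ∀ ε : ℝ, 0 < ε → ∀ x,
      ∑ i ∈ s, (if x ∈ localParallelSet ε (K i) B then a i else 0) = 0)
    (j : Fin (d + 1)) : ∑ i ∈ s, a i * convexCurvature j (K i) B = 0 := by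
  have hex : ∀ i, ∃ P : Polynomial ℝ, i ∈ s → P.natDegree ≤ d ∧
      ∀ ε : ℝ, 0 < ε → (volume (localParallelSet ε (K i) B)).toReal = P.eval ε := fun i => by
    by_cases hi : i ∈ s
    · obtain ⟨P, hP⟩ := exists_steiner_polynomial (hK i hi) hB
      exact ⟨P, fun _ => hP⟩
    · exact ⟨0, fun h => absurd h hi⟩
  choose P hP using hex
  -- Integrating the relation between indicators gives a relation between Steiner polynomials, hence
  -- between their coefficients.
  have hzero : ∑ i ∈ s, Polynomial.C (a i) * P i = 0 := by
    refine eq_of_eval_eq_of_pos fun ε hε => ?_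
    rw [Polynomial.eval_finsetSum, Polynomial.eval_zero]
    have hint : ∀ i ∈ s, Integrable ((localParallelSet ε (K i) B).indicator fun _ => a i) volume :=
      fun i hi => (integrable_indicator_iff (measurableSet_localParallelSet (hK i hi) ε hB)).2
        (integrableOn_const (volume_localParallelSet_lt_top (hK i hi).1 ε B).ne)
    calc ∑ i ∈ s, (Polynomial.C (a i) * P i).eval ε
        = ∑ i ∈ s, ∫ x, (localParallelSet ε (K i) B).indicator (fun _ => a i) x := by
          refine Finset.sum_congr rfl fun i hi => ?_
          rw [integral_indicator (measurableSet_localParallelSet (hK i hi) ε hB),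
            setIntegral_const, Polynomial.eval_mul, Polynomial.eval_C, ← (hP i hi).2 ε hε,
            Measure.real, smul_eq_mul, mul_comm]
      _ = ∫ x, ∑ i ∈ s, (localParallelSet ε (K i) B).indicator (fun _ => a i) x :=
          (integral_finsetSum _ hint).symm
      _ = 0 := by
          simp only [Set.indicator_apply, h ε hε, integral_zero]
  have := congrArg (fun Q => Polynomial.coeff Q (d - j) / unitBallVolume (d - j)) hzero
  simp only [Polynomial.finsetSum_coeff, Polynomial.coeff_C_mul, Polynomial.coeff_zero, zero_div,
    Finset.sum_div] at this
  rw [← this]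
  refine Finset.sum_congr rfl fun i hi => ?_
  rw [convexCurvature_eq_coeff (hP i hi).1 (hP i hi).2, mul_div_assoc]

-- The value of the step function at `t` minus its right-hand limit there collects exactly the
-- intervals ending at `t`. Each interval has one right endpoint, so summing over `t` gives the
-- claim.
open Classical in
theorem sum_eq_zero_of_sum_Icc {ι : Type*} (s : Finset ι) (a l u : ι → ℝ)
    (hlu : ∀ i ∈ s, l i ≤ u i)
    (h : ∀ t : ℝ, ∑ i ∈ s, (if t ∈ Icc (l i) (u i) then a i else 0) = 0) :
    ∑ i ∈ s, a i = 0 := by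
  have key : ∀ t : ℝ, ∑ i ∈ s, (if u i = t then a i else 0) = 0 := by
    intro t
    -- `t'` is so close to `t` on the right that no endpoint lies in `(t, t']`.
    have hev : ∀ᶠ t' in 𝓝[>] t, ∀ i ∈ s, (t < l i → t' < l i) ∧ (t < u i → t' < u i) := by
      rw [eventually_all_finset]
      intro i _
      have aux : ∀ x : ℝ, ∀ᶠ t' in 𝓝[>] t, t < x → t' < x := fun x => by
        by_cases hx : t < x
        · filter_upwards [nhdsWithin_le_nhds (eventually_lt_nhds hx)] with t' ht' _ using ht'
        · exact Eventually.of_forall fun _ h => absurd h hx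
      exact (aux (l i)).and (aux (u i))
    obtain ⟨t', ht', htt⟩ := (hev.and self_mem_nhdsWithin).exists
    have htt : t < t' := htt
    refine Eq.trans ?_ ((congrArg₂ (· - ·) (h t) (h t')).trans (sub_zero 0))
    rw [← Finset.sum_sub_distrib]
    refine Finset.sum_congr rfl fun i hi => ?_
    obtain ⟨h2, h3⟩ := ht' i hi
    have h4 := hlu i hi
    simp only [mem_Icc]
    by_cases hl : t < l i
    · have := h2 hl
      rw [if_neg (by intro h; linarith), if_neg (by intro h; linarith [h.1]),
        if_neg (by intro h; linarith [h.1]), sub_zero]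
    · rw [not_lt] at hl
      by_cases hu : t < u i
      · have := h3 hu
        rw [if_neg hu.ne', if_pos ⟨hl, hu.le⟩, if_pos ⟨by linarith, by linarith⟩, sub_self]
      · rw [not_lt] at hu
        rw [if_neg (fun h => by linarith [h.2]) (c := l i ≤ t' ∧ t' ≤ u i), sub_zero]
        exact if_congr ⟨fun h => ⟨hl, h.ge⟩, fun h => le_antisymm hu h.2⟩ rfl rfl
  rw [← Finset.sum_fiberwise_of_maps_to (t := s.image u) (g := u)
    (fun i hi => Finset.mem_image_of_mem _ hi)]
  refine Finset.sum_eq_zero fun t _ => ?_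
  rw [Finset.sum_filter]
  exact key t

-- The coordinate `u` maps a nonempty compact convex set onto a compact interval, which reduces the
-- claim to intervals.
open Classical in
theorem sum_nonempty_eq_zero_of_level {d : ℕ} {ι : Type*} (s : Finset ι) (a : ι → ℝ)
    (L : ι → Set (E d)) (hL : ∀ i ∈ s, IsCompact (L i) ∧ Convex ℝ (L i)) (u : Fin d)
    (h : ∀ t : ℝ, ∑ i ∈ s, (if (L i ∩ {x | x u = t}).Nonempty then a i else 0) = 0) :
    ∑ i ∈ s, (if (L i).Nonempty then a i else 0) = 0 := by
  have hex : ∀ i, ∃ p : ℝ × ℝ, i ∈ s → (L i).Nonempty →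
      p.1 ≤ p.2 ∧ (fun x : E d => x u) '' L i = Icc p.1 p.2 := by
    intro i
    by_cases hi : i ∈ s ∧ (L i).Nonempty
    · have hne : ((fun x : E d => x u) '' L i).Nonempty := hi.2.image _
      have hconn : IsConnected ((fun x : E d => x u) '' L i) :=
        ⟨hne, ((hL i hi.1).2.isPreconnected).image _ (by fun_prop)⟩
      have hcomp : IsCompact ((fun x : E d => x u) '' L i) := (hL i hi.1).1.image (by fun_prop)
      have := eq_Icc_of_connected_compact hconn hcomp
      refine ⟨(_, _), fun _ _ => ⟨?_, this⟩⟩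
      exact csInf_le_csSup hne hcomp.bddBelow hcomp.bddAbove
    · exact ⟨0, fun h1 h2 => absurd ⟨h1, h2⟩ hi⟩
  choose p hp using hex
  rw [← Finset.sum_filter]
  refine sum_eq_zero_of_sum_Icc _ a (fun i => (p i).1) (fun i => (p i).2)
    (fun i hi => (hp i (Finset.mem_filter.1 hi).1 (Finset.mem_filter.1 hi).2).1) fun t => ?_
  refine Eq.trans ?_ (h t)
  rw [Finset.sum_filter]
  refine Finset.sum_congr rfl fun i hi => ?_
  by_cases hne : (L i).Nonempty
  · rw [if_pos hne]
    refine if_congr (Iff.trans (by rw [← (hp i hi hne).2]) ⟨?_, ?_⟩) rfl rfl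
    · rintro ⟨x, hx, h⟩; exact ⟨x, hx, h⟩
    · rintro ⟨x, hx, h⟩; exact ⟨x, hx, h⟩
  · rw [if_neg hne, if_neg fun h => hne (h.mono inter_subset_left)]

open Classical in
/-- The Euler characteristic is well defined: a linear relation between indicator functions of
compact convex sets passes to the indicators of nonemptiness. -/
theorem sum_nonempty_eq_zero {d : ℕ} {ι : Type*} (s : Finset ι) (a : ι → ℝ)
    (K : ι → Set (E d)) (hK : ∀ i ∈ s, IsCompact (K i) ∧ Convex ℝ (K i))
    (h : ∀ x, ∑ i ∈ s, (if x ∈ K i then a i else 0) = 0) :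
    ∑ i ∈ s, (if (K i).Nonempty then a i else 0) = 0 := by
  -- Coordinates in `U` are free and the others are pinned to those of `c`. The empty `U` is the
  -- hypothesis, the full one the goal.
  have key : ∀ (U : Finset (Fin d)) (c : E d),
      ∑ i ∈ s, (if (K i ∩ {x | ∀ t, t ∉ U → x t = c t}).Nonempty then a i else 0) = 0 := by
    intro U
    induction U using Finset.induction_on with
    | empty =>
      intro c
      refine Eq.trans ?_ (h c)
      refine Finset.sum_congr rfl fun i _ =>
        if_congr ⟨?_, fun hc => ⟨c, hc, fun _ _ => rfl⟩⟩ rfl rfl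
      rintro ⟨x, hx, hxc⟩
      have : x = c := by ext t; exact hxc t (by simp)
      exact this ▸ hx
    | insert u U hu ih =>
      intro c
      refine sum_nonempty_eq_zero_of_level s a _ (fun i hi => ⟨?_, ?_⟩) u fun t => ?_
      · refine (hK i hi).1.inter_right ?_
        simp only [ofPred_forall]
        exact isClosed_iInter fun t => isClosed_iInter fun _ =>
          isClosed_eq (by fun_prop) continuous_const
      · refine (hK i hi).2.inter fun x hx y hy α β _ _ hαβ t ht => ?_
        simp only [PiLp.add_apply, PiLp.smul_apply, smul_eq_mul, hx t ht, hy t ht]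
        rw [← add_mul, hαβ, one_mul]
      · refine Eq.trans ?_ (ih (WithLp.toLp 2 (Function.update c.ofLp u t)))
        refine Finset.sum_congr rfl fun i _ => ?_
        congr 2
        rw [inter_assoc]
        congr 1
        ext x
        simp only [mem_inter_iff, mem_ofPred_eq, Finset.mem_insert, not_or]
        constructor
        · rintro ⟨h1, h2⟩ r hr
          by_cases hru : r = u
          · subst hru; simpa using h2
          · simpa [hru] using h1 r ⟨hru, hr⟩
        · intro h1
          refine ⟨fun r hr => ?_, by simpa using h1 u hu⟩
          simpa [hr.1] using h1 r hr.2
  simpa using key Finset.univ 0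

-- For convex `K`, a small `δ` and `ρ` slightly below `dist x q`, the indicator of "`q` is the
-- nearest point of `x` in `K`" is the difference of the nonemptiness indicators of `K ∩ B(q, δ)`
-- and `K ∩ B(q, δ) ∩ B(x, ρ)`. Both satisfy the relation.
open Classical in
theorem sum_isNearest_eq_zero {d : ℕ} {ι : Type*} (s : Finset ι) (a : ι → ℝ)
    (K : ι → Set (E d)) (hK : ∀ i ∈ s, IsCompact (K i) ∧ Convex ℝ (K i))
    (h : ∀ x, ∑ i ∈ s, (if x ∈ K i then a i else 0) = 0) (x q : E d) :
    ∑ i ∈ s, (if q ∈ K i ∧ ∀ z ∈ K i, dist x q ≤ dist x z then a i else 0) = 0 := by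
  have hδ : ∀ᶠ δ in 𝓝[>] (0 : ℝ), ∀ i ∈ s, q ∉ K i → K i ∩ Metric.closedBall q δ = ∅ := by
    rw [eventually_all_finset]
    intro i hi
    by_cases hq : q ∈ K i
    · exact Eventually.of_forall fun _ h => absurd hq h
    · obtain ⟨δ, hδ, hsub⟩ := Metric.isOpen_iff.1 (hK i hi).1.isClosed.isOpen_compl q hq
      filter_upwards [nhdsWithin_le_nhds (eventually_lt_nhds hδ)] with δ' hδ' _
      rw [← disjoint_iff_inter_eq_empty, Set.disjoint_left]
      intro y hy hyq
      exact hsub (Metric.closedBall_subset_ball hδ' hyq) hy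
  obtain ⟨δ, hδ, hδ0⟩ := (hδ.and self_mem_nhdsWithin).exists
  have hδ0 : 0 < δ := hδ0
  have hρ : ∀ᶠ ρ in 𝓝[<] (dist x q), ∀ i ∈ s, q ∈ K i → (∃ z ∈ K i, dist x z < dist x q) →
      (K i ∩ Metric.closedBall q δ ∩ Metric.closedBall x ρ).Nonempty := by
    rw [eventually_all_finset]
    intro i hi
    by_cases hq : q ∈ K i ∧ ∃ z ∈ K i, dist x z < dist x q
    · obtain ⟨hq, z, hz, hzq⟩ := hq
      -- If some `z ∈ K i` is closer to `x` than `q`, then by convexity so are points of the segment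
      -- from `q` to `z` within `δ` of `q`.
      obtain ⟨t, ht0, ht1, ht⟩ : ∃ t : ℝ, 0 < t ∧ t ≤ 1 ∧ t * dist z q ≤ δ := by
        refine ⟨min 1 (δ / (dist z q + 1)), by positivity, min_le_left _ _, ?_⟩
        have h0 : 0 ≤ dist z q := dist_nonneg
        calc min 1 (δ / (dist z q + 1)) * dist z q ≤ δ / (dist z q + 1) * dist z q := by
              gcongr; exact min_le_right _ _
          _ ≤ δ := by
              rw [div_mul_eq_mul_div, div_le_iff₀ (by positivity)]; nlinarith
      set y := (1 - t) • q + t • z with hy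
      have hyK : y ∈ K i := (hK i hi).2 hq hz (by linarith) ht0.le (by ring)
      have hyq : dist y q ≤ δ := by
        rw [dist_eq_norm, show y - q = t • (z - q) by rw [hy]; module, norm_smul,
          Real.norm_of_nonneg ht0.le, ← dist_eq_norm]
        exact ht
      have hyx : dist x y < dist x q := by
        rw [dist_eq_norm, show x - y = (1 - t) • (x - q) + t • (x - z) by rw [hy]; module]
        calc _ ≤ (1 - t) * dist x q + t * dist x z := by
              refine (norm_add_le _ _).trans ?_
              rw [norm_smul, norm_smul, Real.norm_of_nonneg ht0.le,
                Real.norm_of_nonneg (by linarith), ← dist_eq_norm, ← dist_eq_norm]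
          _ < dist x q := by nlinarith
      filter_upwards [nhdsWithin_le_nhds (eventually_gt_nhds hyx)] with ρ hρ _ _
      exact ⟨y, ⟨hyK, hyq⟩, by rw [Metric.mem_closedBall, dist_comm]; exact hρ.le⟩
    · exact Eventually.of_forall fun _ h1 h2 => absurd ⟨h1, h2⟩ hq
  -- If `x = q` then `ρ` is negative and the ball around `x` is empty, as it should be.
  obtain ⟨ρ, hρ, hρ0⟩ := (hρ.and self_mem_nhdsWithin).exists
  have hρ0 : ρ < dist x q := hρ0
  have e1 := sum_nonempty_eq_zero s a (fun i => K i ∩ Metric.closedBall q δ)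
    (fun i hi => ⟨(hK i hi).1.inter_right Metric.isClosed_closedBall,
      (hK i hi).2.inter (convex_closedBall _ _)⟩) (fun y => by
      by_cases hy : y ∈ Metric.closedBall q δ
      · simpa [hy] using h y
      · simp [hy])
  have e2 := sum_nonempty_eq_zero s a
    (fun i => K i ∩ Metric.closedBall q δ ∩ Metric.closedBall x ρ)
    (fun i hi => ⟨((hK i hi).1.inter_right Metric.isClosed_closedBall).inter_right
      Metric.isClosed_closedBall,
      ((hK i hi).2.inter (convex_closedBall _ _)).inter (convex_closedBall _ _)⟩) (fun y => by
      by_cases hy : y ∈ Metric.closedBall q δ ∧ y ∈ Metric.closedBall x ρ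
      · simpa only [mem_inter_iff, hy.1, hy.2, and_true] using h y
      · refine Finset.sum_eq_zero fun i _ => if_neg fun h => hy ⟨h.1.2, h.2⟩)
  refine Eq.trans ?_ ((congrArg₂ (· - ·) e1 e2).trans (sub_zero 0))
  rw [← Finset.sum_sub_distrib]
  refine Finset.sum_congr rfl fun i hi => ?_
  by_cases hq : q ∈ K i
  · have hn : (K i ∩ Metric.closedBall q δ).Nonempty :=
      ⟨q, hq, Metric.mem_closedBall_self hδ0.le⟩
    rw [if_pos hn]
    by_cases hz : ∃ z ∈ K i, dist x z < dist x q
    · rw [if_pos (hρ i hi hq hz), sub_self, if_neg]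
      rintro ⟨-, h⟩
      obtain ⟨z, hz, hzq⟩ := hz
      exact absurd (h z hz) (not_le.2 hzq)
    · push Not at hz
      rw [if_pos ⟨hq, hz⟩, if_neg, sub_zero]
      rintro ⟨y, ⟨hy, -⟩, hyx⟩
      rw [Metric.mem_closedBall, dist_comm] at hyx
      linarith [hz y hy]
  · have := hδ i hi hq
    rw [this]
    simp [hq]

-- Only finitely many points `q` occur as nearest points of `x`; split the indicator according to
-- `q`.
open Classical in
theorem sum_localParallelSet_eq_zero {d : ℕ} {ι : Type*} (s : Finset ι) (a : ι → ℝ)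
    (K : ι → Set (E d)) (hK : ∀ i ∈ s, IsCompact (K i) ∧ Convex ℝ (K i))
    (h : ∀ x, ∑ i ∈ s, (if x ∈ K i then a i else 0) = 0) (ε : ℝ) (B : Set (E d)) (x : E d) :
    ∑ i ∈ s, (if x ∈ localParallelSet ε (K i) B then a i else 0) = 0 := by
  have key : ∀ i ∈ s, (if x ∈ localParallelSet ε (K i) B then a i else 0) =
      ∑ q ∈ (s.image fun i => nearestPoint (K i) x).filter fun q => q ∈ B ∧ dist x q ≤ ε,
        (if q ∈ K i ∧ ∀ z ∈ K i, dist x q ≤ dist x z then a i else 0) := by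
    intro i hi
    rcases isBody_or_eq_empty (hK i hi) with hb | he
    swap
    · simp [he, localParallelSet_eq_empty]
    by_cases hx : x ∈ localParallelSet ε (K i) B
    · have hx' := hb.mem_localParallelSet.1 hx
      rw [if_pos hx, Finset.sum_eq_single (nearestPoint (K i) x),
        if_pos (hb.nearestPoint_spec x)]
      · intro q _ hq
        exact if_neg fun h => hq (hb.nearestPoint_eq h.1 h.2).symm
      · intro hq
        exact absurd (Finset.mem_filter.2 ⟨Finset.mem_image_of_mem _ hi, hx'⟩) hq
    · rw [if_neg hx]
      refine (Finset.sum_eq_zero fun q hq => if_neg fun h => hx ?_).symm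
      exact ⟨q, ⟨h.1, (Finset.mem_filter.1 hq).2.1⟩, h.2, (Finset.mem_filter.1 hq).2.2⟩
  rw [Finset.sum_congr rfl key, Finset.sum_comm]
  exact Finset.sum_eq_zero fun q _ => sum_isNearest_eq_zero s a K hK h x q

theorem IsConvexRepr.compact_convex_iInter {d m : ℕ} {F : Set (E d)} {K : Fin m → Set (E d)}
    (h : IsConvexRepr F m K) {I : Finset (Fin m)} (hI : I.Nonempty) :
    IsCompact (⋂ i ∈ I, K i) ∧ Convex ℝ (⋂ i ∈ I, K i) := by
  obtain ⟨i, hi⟩ := hI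
  refine ⟨(h.1 i).1.of_isClosed_subset ?_ (biInter_subset_of_mem hi), ?_⟩
  · exact isClosed_biInter fun i _ => (h.1 i).1.isClosed
  · exact convex_iInter₂ fun i _ => (h.1 i).2

open Classical in
theorem IsConvexRepr.sum_ite_mem {d m : ℕ} {F : Set (E d)} {K : Fin m → Set (E d)}
    (h : IsConvexRepr F m K) (x : E d) :
    ∑ I : Finset (Fin m) with I.Nonempty,
      (if x ∈ ⋂ i ∈ I, K i then (-1 : ℝ) ^ (I.card - 1) else 0) = if x ∈ F then 1 else 0 := by
  have := Finset.indicator_biUnion_eq_sum_powerset Finset.univ K (fun _ => (1 : ℝ)) x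
  simp only [Finset.mem_univ, iUnion_true, ← h.2, Finset.powerset_univ] at this
  rw [Set.indicator_apply] at this
  rw [this]
  refine Finset.sum_congr (by ext; simp) fun I hI => ?_
  have hc : 0 < I.card := Finset.card_pos.2 (Finset.mem_filter.1 hI).2
  rw [Set.indicator_apply]
  split_ifs
  · obtain ⟨n, hn⟩ := Nat.exists_eq_add_of_lt hc
    rw [hn]
    simp [pow_succ]
  · simp

open Classical in
/-- The curvature measures of a polyconvex set can be computed from any representation. -/
theorem IsConvexRepr.curvature_eq {d m : ℕ} {F : Set (E d)} {K : Fin m → Set (E d)}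
    (h : IsConvexRepr F m K) {B : Set (E d)} (hB : MeasurableSet B) (j : Fin (d + 1)) :
    curvature j F B = ∑ I : Finset (Fin m) with I.Nonempty,
      (-1 : ℝ) ^ (I.card - 1) * convexCurvature j (⋂ i ∈ I, K i) B := by
  have hF : IsPolyconvex F := ⟨m, K, h⟩
  rw [curvature, dif_pos hF]
  set m' := hF.choose
  set K' : Fin m' → Set (E d) := hF.choose_spec.choose
  have h' : IsConvexRepr F m' K' := hF.choose_spec.choose_spec
  set s : Finset (Finset (Fin m')) := Finset.univ.filter fun I => I.Nonempty
  set t : Finset (Finset (Fin m)) := Finset.univ.filter fun I => I.Nonempty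
  -- Both inclusion-exclusion sums are joined with opposite signs: the indicators then cancel, since
  -- each sum gives the indicator of `F`.
  set a : Finset (Fin m') ⊕ Finset (Fin m) → ℝ :=
    Sum.elim (fun I => (-1 : ℝ) ^ (I.card - 1)) (fun I => -(-1 : ℝ) ^ (I.card - 1))
  set L : Finset (Fin m') ⊕ Finset (Fin m) → Set (E d) :=
    Sum.elim (fun I => ⋂ i ∈ I, K' i) (fun I => ⋂ i ∈ I, K i)
  have hL : ∀ i ∈ s.disjSum t, IsCompact (L i) ∧ Convex ℝ (L i) := by
    rintro (I | I) hI
    · exact h'.compact_convex_iInter (Finset.mem_filter.1 (Finset.inl_mem_disjSum.1 hI)).2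
    · exact h.compact_convex_iInter (Finset.mem_filter.1 (Finset.inr_mem_disjSum.1 hI)).2
  have hrel : ∀ x, ∑ i ∈ s.disjSum t, (if x ∈ L i then a i else 0) = 0 := by
    intro x
    have e1 := h'.sum_ite_mem x
    have e2 := h.sum_ite_mem x
    rw [Finset.sum_disjSum]
    have e3 : ∑ I ∈ t, (if x ∈ L (Sum.inr I) then a (Sum.inr I) else 0) =
        -∑ I ∈ t, (if x ∈ ⋂ i ∈ I, K i then (-1 : ℝ) ^ (I.card - 1) else 0) := by
      rw [← Finset.sum_neg_distrib]
      refine Finset.sum_congr rfl fun I _ => ?_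
      by_cases hx : x ∈ ⋂ i ∈ I, K i
      · exact (if_pos hx).trans (by rw [if_pos hx]; rfl)
      · exact (if_neg hx).trans (by rw [if_neg hx, neg_zero])
    rw [e3, e2, ← e1]
    exact add_neg_cancel _
  have key := sum_mul_convexCurvature_eq_zero (s.disjSum t) a L hL hB
    (fun ε _ x => sum_localParallelSet_eq_zero _ a L hL hrel ε B x) j
  rw [Finset.sum_disjSum] at key
  simp only [a, L, Sum.elim_inl, Sum.elim_inr, neg_mul, Finset.sum_neg_distrib] at key
  exact add_neg_eq_zero.1 key

/-! ### Behaviour of curvatures, exponents and averages under dilation. -/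

theorem localParallelSet_smul {d : ℕ} {r : ℝ} (hr : 0 < r) (ε : ℝ) (K B : Set (E d)) :
    localParallelSet (r * ε) (r • K) (r • B) = r • localParallelSet ε K B := by
  have hdist : ∀ a b : E d, dist (r • a) (r • b) = r * dist a b := fun a b => by
    rw [dist_smul₀, Real.norm_of_nonneg hr.le]
  ext x
  rw [mem_smul_set]
  constructor
  · rintro ⟨y, ⟨⟨y', hy', rfl⟩, hB⟩, h1, h2⟩
    have hx : r • r⁻¹ • x = x := smul_inv_smul₀ hr.ne' x
    refine ⟨r⁻¹ • x, ⟨y', ⟨hy', (smul_mem_smul_set_iff₀ hr.ne' _ _).1 hB⟩, fun z hz => ?_, ?_⟩, hx⟩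
    · have := h1 (r • z) (smul_mem_smul_set hz)
      rw [← hx] at this
      simp only [hdist] at this
      exact le_of_mul_le_mul_left this hr
    · simp only at h2
      rw [← hx, hdist] at h2
      exact le_of_mul_le_mul_left h2 hr
  · rintro ⟨y, ⟨q, ⟨hq, hB⟩, h1, h2⟩, rfl⟩
    refine ⟨r • q, ⟨smul_mem_smul_set hq, smul_mem_smul_set hB⟩, ?_, ?_⟩
    · rintro _ ⟨z, hz, rfl⟩
      simp only [hdist]
      exact mul_le_mul_of_nonneg_left (h1 z hz) hr.le
    · rw [hdist]
      exact mul_le_mul_of_nonneg_left h2 hr.le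

-- The Steiner polynomial becomes `r^d P(ε / r)`, and `r^d r^(-(d - j)) = r^j`.
open Polynomial in
theorem convexCurvature_smul {d : ℕ} {r : ℝ} (hr : 0 < r) {K B : Set (E d)}
    (hK : IsCompact K ∧ Convex ℝ K) (hB : MeasurableSet B) (j : Fin (d + 1)) :
    convexCurvature j (r • K) (r • B) = r ^ (j : ℕ) * convexCurvature j K B := by
  obtain ⟨P, hP, hPe⟩ := exists_steiner_polynomial hK hB
  have hdeg : (C (r ^ d) * P.comp (C r⁻¹ * X)).natDegree ≤ d := by
    refine (natDegree_C_mul_le _ _).trans (natDegree_comp_le.trans ?_)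
    calc _ ≤ d * 1 := Nat.mul_le_mul hP ((natDegree_C_mul_le _ _).trans natDegree_X_le)
      _ = d := mul_one d
  rw [convexCurvature_eq_coeff hP hPe, convexCurvature_eq_coeff hdeg fun ε hε => ?_]
  · rw [coeff_C_mul, comp_C_mul_X_coeff]
    have : r ^ d * (r⁻¹) ^ (d - (j : ℕ)) = r ^ (j : ℕ) := by
      rw [inv_pow, ← div_eq_mul_inv, div_eq_iff (by positivity), ← pow_add]
      congr 1
      have := j.2
      omega
    rw [← this]; ring
  · have h1 : ε = r * (r⁻¹ * ε) := by field_simp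
    have h2 : 0 < r⁻¹ * ε := by positivity
    conv_lhs => rw [h1]
    rw [localParallelSet_smul hr, Measure.addHaar_smul_of_nonneg _ hr.le, ENNReal.toReal_mul,
      hPe _ h2, ENNReal.toReal_ofReal (by positivity)]
    simp

theorem IsConvexRepr.smul {d m : ℕ} {F : Set (E d)} {K : Fin m → Set (E d)}
    (h : IsConvexRepr F m K) (r : ℝ) : IsConvexRepr (r • F) m fun i => r • K i := by
  refine ⟨fun i => ⟨(h.1 i).1.smul r, (h.1 i).2.smul r⟩, ?_⟩
  rw [h.2, smul_set_iUnion]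

theorem IsPolyconvex.smul {d : ℕ} {F : Set (E d)} (h : IsPolyconvex F) (r : ℝ) :
    IsPolyconvex (r • F) := by
  obtain ⟨m, K, hK⟩ := h
  exact ⟨m, _, hK.smul r⟩

theorem isPolyconvex_smul_iff {d : ℕ} {F : Set (E d)} {r : ℝ} (hr : 0 < r) :
    IsPolyconvex (r • F) ↔ IsPolyconvex F :=
  ⟨fun h => by simpa [smul_smul, hr.ne'] using h.smul r⁻¹, fun h => h.smul r⟩

theorem curvature_smul {d : ℕ} {r : ℝ} (hr : 0 < r) (F : Set (E d)) {B : Set (E d)}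
    (hB : MeasurableSet B) (j : Fin (d + 1)) :
    curvature j (r • F) (r • B) = r ^ (j : ℕ) * curvature j F B := by
  classical
  by_cases hF : IsPolyconvex F
  · obtain ⟨m, K, hK⟩ := hF
    rw [hK.curvature_eq hB, (hK.smul r).curvature_eq (hB.const_smul₀ r), Finset.mul_sum]
    refine Finset.sum_congr rfl fun I hI => ?_
    have hI' : I.Nonempty := (Finset.mem_filter.1 hI).2
    have : ⋂ i ∈ I, r • K i = r • ⋂ i ∈ I, K i := by
      ext x
      simp only [mem_iInter, mem_smul_set_iff_inv_smul_mem₀ hr.ne']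
    rw [this, convexCurvature_smul hr (hK.compact_convex_iInter hI') hB]
    ring
  · rw [curvature, curvature, dif_neg hF, dif_neg ((isPolyconvex_smul_iff hr).not.2 hF), mul_zero]

theorem totalCurvature_smul {d : ℕ} {r : ℝ} (hr : 0 < r) (F : Set (E d)) (j : Fin (d + 1)) :
    totalCurvature j (r • F) = r ^ (j : ℕ) * totalCurvature j F := by
  rw [totalCurvature, totalCurvature, ← curvature_smul hr F MeasurableSet.univ,
    smul_set_univ₀ hr.ne']

theorem curvatureVar_smul {d : ℕ} {r : ℝ} (hr : 0 < r) (F : Set (E d)) (j : Fin (d + 1)) :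
    curvatureVar j (r • F) = r ^ (j : ℕ) * curvatureVar j F := by
  have hset : {x | ∃ B, MeasurableSet B ∧ B ⊆ univ ∧ x = curvature j (r • F) B} =
      (r ^ (j : ℕ)) • {x | ∃ B, MeasurableSet B ∧ B ⊆ univ ∧ x = curvature j F B} := by
    ext x
    rw [mem_smul_set]
    constructor
    · rintro ⟨B, hB, -, rfl⟩
      refine ⟨_, ⟨r⁻¹ • B, hB.const_smul₀ _, subset_univ _, rfl⟩, ?_⟩
      rw [smul_eq_mul, ← curvature_smul hr F (hB.const_smul₀ _), smul_inv_smul₀ hr.ne']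
    · rintro ⟨_, ⟨B, hB, -, rfl⟩, rfl⟩
      exact ⟨r • B, hB.const_smul₀ _, subset_univ _, by rw [curvature_smul hr F hB, smul_eq_mul]⟩
  have hr' : 0 ≤ r ^ (j : ℕ) := by positivity
  rw [curvatureVar, curvatureVar, posVariation, posVariation, negVariation, negVariation, hset,
    Real.sSup_smul_of_nonneg hr', Real.sInf_smul_of_nonneg hr', smul_eq_mul, smul_eq_mul]
  ring

theorem cthickening_smul {d : ℕ} {r : ℝ} (hr : 0 < r) (ε : ℝ) (A : Set (E d)) :
    Metric.cthickening (r * ε) (r • A) = r • Metric.cthickening ε A := by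
  ext x
  obtain ⟨y, rfl⟩ : ∃ y, x = r • y := ⟨r⁻¹ • x, (smul_inv_smul₀ hr.ne' x).symm⟩
  rw [smul_mem_smul_set_iff₀ hr.ne', Metric.mem_cthickening_iff, Metric.mem_cthickening_iff,
    infEDist_smul₀ hr.ne', ENNReal.ofReal_mul hr.le, ENNReal.smul_def, smul_eq_mul,
    ← enorm_eq_nnnorm, Real.enorm_of_nonneg hr.le]
  exact ENNReal.mul_le_mul_iff_right (by simpa using hr) ENNReal.ofReal_ne_top

theorem tendsto_inv_mul_nhdsGT {r : ℝ} (hr : 0 < r) :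
    Tendsto (fun ε : ℝ => r⁻¹ * ε) (𝓝[>] 0) (𝓝[>] 0) := by
  refine tendsto_nhdsWithin_iff.2 ⟨?_, ?_⟩
  · have : Continuous fun ε : ℝ => r⁻¹ * ε := by fun_prop
    simpa using (this.tendsto 0).mono_left nhdsWithin_le_nhds
  · filter_upwards [self_mem_nhdsWithin] with ε hε
    have : (0 : ℝ) < ε := hε
    exact mem_Ioi.2 (by positivity)

theorem cthickening_smul_eq {d : ℕ} {r : ℝ} (hr : 0 < r) (ε : ℝ) (A : Set (E d)) :
    Metric.cthickening ε (r • A) = r • Metric.cthickening (r⁻¹ * ε) A := by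
  rw [← cthickening_smul hr, mul_inv_cancel_left₀ hr.ne']

theorem tendsto_curvatureVar_smul {d : ℕ} {r : ℝ} (hr : 0 < r) {A : Set (E d)} {j : Fin (d + 1)}
    {t : ℝ} (h : Tendsto (fun ε : ℝ => ε ^ t * curvatureVar j (Metric.cthickening ε A))
      (𝓝[>] 0) (𝓝 0)) :
    Tendsto (fun ε : ℝ => ε ^ t * curvatureVar j (Metric.cthickening ε (r • A)))
      (𝓝[>] 0) (𝓝 0) := by
  have h1 := (h.comp (tendsto_inv_mul_nhdsGT hr)).const_mul (r ^ t * r ^ (j : ℕ))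
  rw [mul_zero] at h1
  refine h1.congr' ?_
  filter_upwards [self_mem_nhdsWithin] with ε hε
  have hε : 0 < ε := hε
  simp only [Function.comp_apply]
  rw [cthickening_smul_eq hr, curvatureVar_smul hr, Real.mul_rpow (by positivity) hε.le,
    Real.inv_rpow hr.le]
  have : r ^ t ≠ 0 := (Real.rpow_pos_of_pos hr t).ne'
  field_simp

theorem scalingExponent_smul {d : ℕ} {r : ℝ} (hr : 0 < r) (A : Set (E d)) (j : Fin (d + 1)) :
    scalingExponent j (r • A) = scalingExponent j A := by
  rw [scalingExponent, scalingExponent]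
  congr 2
  ext t
  refine ⟨fun h => ?_, tendsto_curvatureVar_smul hr⟩
  have := tendsto_curvatureVar_smul (inv_pos.2 hr) h
  rwa [inv_smul_smul₀ hr.ne'] at this

theorem HasAverageFractalCurvature.smul {d : ℕ} {r : ℝ} (hr : 0 < r) {A : Set (E d)}
    {j : Fin (d + 1)} {c s : ℝ} (h : HasAverageFractalCurvature j A c)
    (hs : scalingExponent j A = (s : EReal)) :
    HasAverageFractalCurvature j (r • A) (r ^ (s + (j : ℕ)) * c) := by
  obtain ⟨hA, s', hs', ε₀, hε₀, hpoly, hint, hlim⟩ := h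
  obtain rfl : s' = s := by rw [hs'] at hs; exact EReal.coe_injective hs
  set f : ℝ → ℝ := fun ε => ε ^ s' * totalCurvature j (Metric.cthickening ε A) / ε with hf
  have hfun : ∀ ε : ℝ, 0 < ε →
      ε ^ s' * totalCurvature j (Metric.cthickening ε (r • A)) / ε =
        r ^ (s' + (j : ℕ)) * (r⁻¹ * f (r⁻¹ * ε)) := by
    intro ε hε
    rw [cthickening_smul_eq hr, totalCurvature_smul hr, hf, Real.rpow_add_natCast hr.ne']
    simp only
    rw [Real.mul_rpow (by positivity) hε.le, Real.inv_rpow hr.le]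
    have : r ^ s' ≠ 0 := (Real.rpow_pos_of_pos hr s').ne'
    field_simp
  have hcongr : ∀ δ ∈ Ioo 0 (r * ε₀), ∀ ε ∈ uIcc δ (r * ε₀), 0 < ε := fun δ hδ ε hε =>
    lt_of_lt_of_le (lt_min hδ.1 (by positivity)) hε.1
  -- With upper limit `r * ε₀` the substitution `ε = rη` leaves the logarithmic normalization
  -- unchanged.
  refine ⟨hA.smul r, s', (scalingExponent_smul hr A j).trans hs', r * ε₀, by positivity,
    fun ε hε => ?_, fun δ hδ => ?_, ?_⟩
  · rw [cthickening_smul_eq hr]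
    refine (hpoly _ ⟨by have := hε.1; positivity, ?_⟩).smul r
    rw [inv_mul_le_iff₀ hr]; exact hε.2
  · have h1 : IntervalIntegrable f volume (r⁻¹ * δ) ε₀ := hint _
      ⟨by have := hδ.1; positivity, by rw [inv_mul_lt_iff₀ hr]; exact hδ.2⟩
    have h2 : IntervalIntegrable (fun ε => r ^ (s' + (j : ℕ)) * (r⁻¹ * f (r⁻¹ * ε))) volume
        δ (r * ε₀) := by
      have h3 := h1.comp_mul_left (c := r⁻¹)
      rw [mul_div_cancel_left₀ _ (inv_ne_zero hr.ne'), div_inv_eq_mul, mul_comm ε₀] at h3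
      exact (h3.const_mul _).const_mul _
    refine h2.congr fun ε hε => ?_
    exact (hfun ε (hcongr δ hδ ε (uIoc_subset_uIcc hε))).symm
  · have h1 := (hlim.comp (tendsto_inv_mul_nhdsGT hr)).const_mul (r ^ (s' + (j : ℕ)))
    refine h1.congr' ?_
    filter_upwards [Ioo_mem_nhdsGT (show (0 : ℝ) < r * ε₀ by positivity)] with δ hδ
    have h2 : ∫ ε in δ..(r * ε₀), ε ^ s' * totalCurvature j (Metric.cthickening ε (r • A)) / ε =
        r ^ (s' + (j : ℕ)) * ∫ ε in (r⁻¹ * δ)..ε₀, f ε := by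
      rw [intervalIntegral.integral_congr (g := fun ε => r ^ (s' + (j : ℕ)) * (r⁻¹ * f (r⁻¹ * ε)))
        fun ε hε => hfun ε (hcongr δ hδ ε hε), intervalIntegral.integral_const_mul,
        intervalIntegral.integral_const_mul, intervalIntegral.integral_comp_mul_left _
          (inv_ne_zero hr.ne'), inv_mul_cancel_left₀ hr.ne', smul_eq_mul, inv_inv,
        inv_mul_cancel_left₀ hr.ne']
    rw [h2]
    simp only [Function.comp_apply]
    rw [Real.log_mul hr.ne' hε₀.ne', Real.log_mul (inv_ne_zero hr.ne') hδ.1.ne', Real.log_inv,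
      show Real.log ε₀ - (-Real.log r + Real.log δ) = Real.log r + Real.log ε₀ - Real.log δ by ring]
    ring

/-- The average fractal curvature does not depend on the upper limit of integration. -/
theorem HasAverageFractalCurvature.unique {d : ℕ} {A : Set (E d)} {j : Fin (d + 1)} {c c' : ℝ}
    (h : HasAverageFractalCurvature j A c) (h' : HasAverageFractalCurvature j A c') : c = c' := by
  obtain ⟨-, s, hs, ε₀, hε₀, -, hint, hlim⟩ := h
  obtain ⟨-, s', hs', ε₁, hε₁, -, hint', hlim'⟩ := h'
  obtain rfl : s' = s := by rw [hs'] at hs; exact EReal.coe_injective hs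
  set f : ℝ → ℝ := fun ε => ε ^ s' * totalCurvature j (Metric.cthickening ε A) / ε
  have hlog : Tendsto (fun δ : ℝ => -Real.log δ) (𝓝[>] 0) atTop :=
    tendsto_neg_atBot_atTop.comp Real.tendsto_log_nhdsGT_zero
  have hlogc : ∀ a : ℝ, Tendsto (fun δ : ℝ => Real.log a - Real.log δ) (𝓝[>] 0) atTop := fun a => by
    simpa [sub_eq_add_neg] using tendsto_atTop_add_const_left _ (Real.log a) hlog
  -- Changing the upper limit adds a fixed integral, negligible against `-log δ`, and changes the
  -- normalization by a factor tending to `1`.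
  have hratio : Tendsto (fun δ : ℝ => (Real.log ε₀ - Real.log δ) / (Real.log ε₁ - Real.log δ))
      (𝓝[>] 0) (𝓝 1) := by
    have h1 : Tendsto (fun δ : ℝ => 1 + (Real.log ε₀ - Real.log ε₁) / (Real.log ε₁ - Real.log δ))
        (𝓝[>] 0) (𝓝 (1 + 0)) := tendsto_const_nhds.add (tendsto_const_nhds.div_atTop (hlogc ε₁))
    rw [add_zero] at h1
    refine h1.congr' ?_
    filter_upwards [(hlogc ε₁).eventually_gt_atTop 0] with δ hδ
    field_simp
    ring
  have hconst : Tendsto (fun δ : ℝ => (∫ ε in ε₀..ε₁, f ε) / (Real.log ε₁ - Real.log δ))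
      (𝓝[>] 0) (𝓝 0) := tendsto_const_nhds.div_atTop (hlogc ε₁)
  have h2 := (hratio.mul hlim).add hconst
  rw [one_mul, add_zero] at h2
  refine tendsto_nhds_unique (h2.congr' ?_) hlim'
  filter_upwards [(hlogc ε₁).eventually_gt_atTop 0, (hlogc ε₀).eventually_gt_atTop 0,
    Ioo_mem_nhdsGT hε₀, Ioo_mem_nhdsGT hε₁] with δ h0 h1 hδ0 hδ1
  have hI : ∫ ε in δ..ε₁, f ε = (∫ ε in δ..ε₀, f ε) + ∫ ε in ε₀..ε₁, f ε :=
    (intervalIntegral.integral_add_adjacent_intervals (hint δ hδ0)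
      ((hint δ hδ0).symm.trans (hint' δ hδ1))).symm
  change _ = 1 / (Real.log ε₁ - Real.log δ) * ∫ ε in δ..ε₁, f ε
  rw [hI]
  change _ / _ * (1 / (Real.log ε₀ - Real.log δ) * ∫ ε in δ..ε₀, f ε) + _ = _
  field_simp

theorem HasAverageFractalCurvature.averageFractalCurvature_eq {d : ℕ} {A : Set (E d)}
    {j : Fin (d + 1)} {c : ℝ} (h : HasAverageFractalCurvature j A c) :
    averageFractalCurvature j A = c := by
  have hex : ∃ c, HasAverageFractalCurvature j A c := ⟨c, h⟩
  rw [averageFractalCurvature, dif_pos hex]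
  exact hex.choose_spec.unique h

theorem specificCurvature_smul {d : ℕ} {k : Fin d} {A : Set (E d)}
    (hA : SpecificCurvatureWellDefined A) {r : ℝ} (hr : 0 < r) {s : Fin (d + 1) → ℝ}
    (hs : ∀ j, scalingExponent j A = (s j : EReal)) :
    SpecificCurvatureWellDefined (r • A) ∧ specificCurvature k (r • A) =
      r ^ (s k.castSucc + (k : ℕ) - (s (Fin.last d) + d)) * specificCurvature k A := by
  obtain ⟨hex, hpos⟩ := hA
  have havg : ∀ j, HasAverageFractalCurvature j (r • A)
      (r ^ (s j + (j : ℕ)) * averageFractalCurvature j A) := fun j => by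
    obtain ⟨c, hc⟩ := hex j
    rw [hc.averageFractalCurvature_eq]
    exact hc.smul hr (hs j)
  refine ⟨⟨fun j => ⟨_, havg j⟩, ?_⟩, ?_⟩
  · rw [(havg _).averageFractalCurvature_eq]
    exact mul_pos (Real.rpow_pos_of_pos hr _) hpos
  · rw [specificCurvature, specificCurvature, (havg _).averageFractalCurvature_eq,
      (havg _).averageFractalCurvature_eq, Real.rpow_sub hr, mul_div_mul_comm]
    simp

/-! ### Scaling exponents of polyconvex sets: the upper bound and the top index. -/

theorem cthickening_iUnion_fin {d m : ℕ} (K : Fin m → Set (E d)) (ε : ℝ) :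
    Metric.cthickening ε (⋃ i, K i) = ⋃ i, Metric.cthickening ε (K i) := by
  ext x
  simp only [mem_iUnion, Metric.mem_cthickening_iff, Metric.infEDist_iUnion]
  constructor
  · intro h
    rcases isEmpty_or_nonempty (Fin m) with hm | hm
    · rw [iInf_of_empty] at h
      exact absurd h (by simp)
    · obtain ⟨i, hi⟩ := exists_eq_ciInf_of_finite (f := fun i => Metric.infEDist x (K i))
      exact ⟨i, hi.trans_le h⟩
  · rintro ⟨i, hi⟩
    exact (iInf_le _ i).trans hi

theorem IsConvexRepr.cthickening {d m : ℕ} {A : Set (E d)} {K : Fin m → Set (E d)}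
    (h : IsConvexRepr A m K) (ε : ℝ) :
    IsConvexRepr (Metric.cthickening ε A) m fun i => Metric.cthickening ε (K i) :=
  ⟨fun i => ⟨(h.1 i).1.cthickening, (h.1 i).2.cthickening ε⟩, by
    rw [h.2, cthickening_iUnion_fin]⟩

theorem IsConvexRepr.isCompact {d m : ℕ} {A : Set (E d)} {K : Fin m → Set (E d)}
    (h : IsConvexRepr A m K) : IsCompact A := by
  rw [h.2]
  exact isCompact_iUnion fun i => (h.1 i).1

/-- The number of inclusion-exclusion terms does not depend on `ε`, and all the convex sets involved
lie in the parallel set of `A` of radius `1`. -/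
theorem IsConvexRepr.exists_curvature_bound {d m : ℕ} {A : Set (E d)} {K : Fin m → Set (E d)}
    (h : IsConvexRepr A m K) (j : Fin (d + 1)) :
    ∃ c : ℝ, ∀ ε ≤ 1, ∀ B, MeasurableSet B → |curvature j (Metric.cthickening ε A) B| ≤ c := by
  classical
  obtain ⟨c, hc0, hc⟩ := exists_convexCurvature_bound j (h.isCompact.cthickening (r := 1))
  refine ⟨∑ I : Finset (Fin m) with I.Nonempty, c, fun ε hε B hB => ?_⟩
  rw [(h.cthickening ε).curvature_eq hB]
  refine (Finset.abs_sum_le_sum_abs _ _).trans (Finset.sum_le_sum fun I hI => ?_)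
  rw [abs_mul, abs_pow, abs_neg, abs_one, one_pow, one_mul]
  have hI' := (Finset.mem_filter.1 hI).2
  refine hc _ _ ((h.cthickening ε).compact_convex_iInter hI') ?_ hB
  obtain ⟨i, hi⟩ := hI'
  refine (biInter_subset_of_mem hi).trans ((Metric.cthickening_mono hε _).trans ?_)
  rw [h.2]
  exact Metric.cthickening_subset_of_subset _ (subset_iUnion K i)

theorem curvature_empty {d : ℕ} (j : Fin (d + 1)) (F : Set (E d)) : curvature j F ∅ = 0 := by
  rw [curvature]
  split_ifs
  · exact Finset.sum_eq_zero fun I _ => by rw [convexCurvature_eq_zero (by simp), mul_zero]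
  · rfl

theorem abs_curvature_le_curvatureVar {d : ℕ} {j : Fin (d + 1)} {F : Set (E d)} {c : ℝ}
    (hc : ∀ B, MeasurableSet B → |curvature j F B| ≤ c) {B : Set (E d)} (hB : MeasurableSet B) :
    |curvature j F B| ≤ curvatureVar j F := by
  set S := {x | ∃ B, MeasurableSet B ∧ B ⊆ univ ∧ x = curvature j F B} with hS
  have hmem : ∀ B, MeasurableSet B → curvature j F B ∈ S := fun B hB => ⟨B, hB, subset_univ _, rfl⟩
  have hup : BddAbove S := ⟨c, by rintro _ ⟨B, hB, -, rfl⟩; exact (abs_le.1 (hc B hB)).2⟩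
  have hlow : BddBelow S := ⟨-c, by rintro _ ⟨B, hB, -, rfl⟩; exact (abs_le.1 (hc B hB)).1⟩
  have h0 : (0 : ℝ) ∈ S := curvature_empty j F ▸ hmem ∅ MeasurableSet.empty
  have h1 := le_csSup hup (hmem B hB)
  have h2 := le_csSup hup h0
  have h3 := csInf_le hlow (hmem B hB)
  have h4 := csInf_le hlow h0
  rw [curvatureVar, posVariation, negVariation, ← hS, abs_le]
  constructor <;> linarith

theorem curvatureVar_le {d : ℕ} {j : Fin (d + 1)} {F : Set (E d)} {c : ℝ}
    (hc : ∀ B, MeasurableSet B → |curvature j F B| ≤ c) : curvatureVar j F ≤ 2 * c := by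
  set S := {x | ∃ B, MeasurableSet B ∧ B ⊆ univ ∧ x = curvature j F B} with hS
  have hne : S.Nonempty := ⟨_, ∅, MeasurableSet.empty, subset_univ _, rfl⟩
  have h1 : sSup S ≤ c :=
    csSup_le hne (by rintro _ ⟨B, hB, -, rfl⟩; exact (abs_le.1 (hc B hB)).2)
  have h2 : -c ≤ sInf S :=
    le_csInf hne (by rintro _ ⟨B, hB, -, rfl⟩; exact (abs_le.1 (hc B hB)).1)
  rw [curvatureVar, posVariation, negVariation, ← hS]
  linarith

/-- Boundedness of the variation admits every `t > 0`. An admissible `t < 0` would force the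
variation, which is `ε^(-t)` times `ε^t C_j^var(A_ε)`, to tend to `0`. -/
theorem IsConvexRepr.scalingExponent_eq_zero {d m : ℕ} {A : Set (E d)} {K : Fin m → Set (E d)}
    (h : IsConvexRepr A m K) {j : Fin (d + 1)}
    (hnot : ¬ Tendsto (fun ε : ℝ => curvatureVar j (Metric.cthickening ε A)) (𝓝[>] 0) (𝓝 0)) :
    scalingExponent j A = ((0 : ℝ) : EReal) := by
  obtain ⟨c, hc⟩ := h.exists_curvature_bound j
  rw [scalingExponent]
  refine le_antisymm ?_ ?_
  · refine le_of_forall_gt_imp_ge_of_dense fun y hy => ?_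
    obtain ⟨t, ht0, hty⟩ := EReal.lt_iff_exists_real_btwn.1 hy
    have ht0 : 0 < t := EReal.coe_lt_coe_iff.1 ht0
    suffices ht : Tendsto (fun ε : ℝ => ε ^ t * curvatureVar j (Metric.cthickening ε A))
        (𝓝[>] 0) (𝓝 0) by
      refine le_trans (sInf_le ?_) hty.le
      exact ⟨t, ht, rfl⟩
    have h1 : Tendsto (fun ε : ℝ => ε ^ t) (𝓝[>] 0) (𝓝 0) := by
      have := (Real.continuousAt_rpow_const 0 t (Or.inr ht0.le)).tendsto
      rw [Real.zero_rpow ht0.ne'] at this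
      exact this.mono_left nhdsWithin_le_nhds
    refine h1.zero_mul_isBoundedUnder_le (isBoundedUnder_of_eventually_le (a := 2 * c) ?_)
    filter_upwards [Ioo_mem_nhdsGT (zero_lt_one' ℝ)] with ε hε
    have hb := hc ε hε.2.le
    have h0 : 0 ≤ curvatureVar j (Metric.cthickening ε A) :=
      (abs_nonneg _).trans (abs_curvature_le_curvatureVar hb MeasurableSet.empty)
    simp only [Function.comp_apply, Real.norm_of_nonneg h0]
    exact curvatureVar_le hb
  · refine le_sInf ?_
    rintro _ ⟨t, ht, rfl⟩
    rw [EReal.coe_le_coe_iff]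
    by_contra! hneg
    refine hnot ?_
    have h1 : Tendsto (fun ε : ℝ => ε ^ (-t)) (𝓝[>] 0) (𝓝 0) := by
      have := (Real.continuousAt_rpow_const 0 (-t) (Or.inr (by linarith))).tendsto
      rw [Real.zero_rpow (by linarith)] at this
      exact this.mono_left nhdsWithin_le_nhds
    have h2 := h1.mul ht
    rw [mul_zero] at h2
    refine h2.congr' ?_
    filter_upwards [self_mem_nhdsWithin] with ε hε
    rw [← mul_assoc, ← Real.rpow_add hε]
    simp

theorem unitBallVolume_zero : unitBallVolume 0 = 1 := by
  rw [unitBallVolume, volume_euclideanSpace_eq_dirac]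
  simp

/-- The constant Steiner coefficient is the limit of the volumes of the parallel sets as `ε ↓ 0`. -/
theorem convexCurvature_last {d : ℕ} {K : Set (E d)} (hK : IsCompact K ∧ Convex ℝ K) :
    convexCurvature (Fin.last d) K univ = (volume K).toReal := by
  obtain ⟨P, hP, hPe⟩ := exists_steiner_polynomial hK MeasurableSet.univ
  rw [convexCurvature_eq_coeff hP hPe]
  simp only [Fin.val_last, Nat.sub_self, unitBallVolume_zero, div_one]
  rcases isBody_or_eq_empty hK with hb | rfl
  swap
  · have : P = 0 := eq_of_eval_eq_of_pos fun ε hε => by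
      rw [← hPe ε hε, localParallelSet_eq_empty (by simp)]; simp
    simp [this]
  have h1 : Tendsto (fun ε : ℝ => P.eval ε) (𝓝[>] 0) (𝓝 (P.eval 0)) :=
    (P.continuous.tendsto 0).mono_left nhdsWithin_le_nhds
  rw [Polynomial.coeff_zero_eq_eval_zero]
  have h2 : Tendsto (fun ε : ℝ => (volume (Metric.cthickening ε K)).toReal) (𝓝[>] 0)
      (𝓝 (volume K).toReal) :=
    (ENNReal.tendsto_toReal hK.1.measure_lt_top.ne).comp
      ((tendsto_measure_cthickening_of_isCompact hK.1).mono_left nhdsWithin_le_nhds)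
  refine tendsto_nhds_unique (h1.congr' ?_) h2
  filter_upwards [self_mem_nhdsWithin] with ε hε
  have hε : 0 < ε := hε
  rw [← hPe ε hε]
  congr 2
  ext x
  rw [hb.mem_localParallelSet, hb.dist_le_iff_mem_cthickening hε.le]
  simp

theorem IsConvexRepr.curvature_last {d m : ℕ} {F : Set (E d)} {K : Fin m → Set (E d)}
    (h : IsConvexRepr F m K) : curvature (Fin.last d) F univ = (volume F).toReal := by
  classical
  rw [h.curvature_eq MeasurableSet.univ]
  have := measureReal_biUnion_eq_sum_powerset (μ := volume) (t := Finset.univ) (s := K)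
    (fun i _ => (h.1 i).1.measurableSet) (fun i _ => (h.1 i).1.measure_lt_top.ne)
  simp only [Finset.mem_univ, iUnion_true, ← h.2, Finset.powerset_univ] at this
  change _ = volume.real F
  rw [this]
  refine Finset.sum_congr (by ext; simp) fun I hI => ?_
  have hI' : I.Nonempty := (Finset.mem_filter.1 hI).2
  rw [convexCurvature_last (h.compact_convex_iInter hI')]
  obtain ⟨n, hn⟩ := Nat.exists_eq_add_of_lt (Finset.card_pos.2 hI')
  rw [hn, Measure.real]
  simp [pow_succ]

theorem IsConvexRepr.scalingExponent_last {d m : ℕ} {A : Set (E d)} {K : Fin m → Set (E d)}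
    (h : IsConvexRepr A m K) (hA : 0 < volume A) :
    scalingExponent (Fin.last d) A = ((0 : ℝ) : EReal) := by
  refine h.scalingExponent_eq_zero fun hlim => ?_
  obtain ⟨c, hc⟩ := h.exists_curvature_bound (Fin.last d)
  have hfin := h.isCompact.measure_lt_top (μ := volume)
  have hpos : 0 < (volume A).toReal := ENNReal.toReal_pos hA.ne' hfin.ne
  refine absurd (ge_of_tendsto hlim (b := (volume A).toReal) ?_) (not_le.2 hpos)
  filter_upwards [Ioo_mem_nhdsGT (zero_lt_one' ℝ)] with ε hε
  refine le_trans ?_ ((le_abs_self _).trans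
    (abs_curvature_le_curvatureVar (hc ε hε.2.le) MeasurableSet.univ))
  rw [(h.cthickening ε).curvature_last]
  exact ENNReal.toReal_mono h.isCompact.cthickening.measure_lt_top.ne
    (measure_mono (Metric.self_subset_cthickening A))

/-! ### Contact sets: a lower bound for the curvature variation of parallel sets. -/

/-- The points `x` whose nearest point `q` in `K j₀` lies in exactly the sets `K j`, `j ∈ J`, is the
nearest point of `x` in each of these, and has distance more than `ρ` to the remaining sets. -/
def contactSet {d m : ℕ} (K : Fin m → Set (E d)) (J : Finset (Fin m)) (j₀ : Fin m) (ρ : ℝ) :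
    Set (E d) :=
  {x | (∀ j ∈ J, nearestPoint (K j₀) x ∈ K j ∧ nearestPoint (K j) x = nearestPoint (K j₀) x) ∧
    ∀ j ∉ J, ENNReal.ofReal ρ < Metric.infEDist (nearestPoint (K j₀) x) (K j)}

section

variable {d m : ℕ} {K : Fin m → Set (E d)} {J : Finset (Fin m)} {j₀ : Fin m} {ρ : ℝ}

theorem measurableSet_contactSet (hJ : ∀ j ∈ J, IsBody (K j)) (hj₀ : j₀ ∈ J) :
    MeasurableSet (contactSet K J j₀ ρ) := by
  have hm : ∀ j ∈ J, Measurable (nearestPoint (K j)) := fun j hj =>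
    (hJ j hj).lipschitz.continuous.measurable
  have : contactSet K J j₀ ρ =
      (⋂ j ∈ J, (nearestPoint (K j₀) ⁻¹' K j ∩
        {x | nearestPoint (K j) x = nearestPoint (K j₀) x})) ∩
      ⋂ j ∈ (Jᶜ : Finset (Fin m)),
        {x | ENNReal.ofReal ρ < Metric.infEDist (nearestPoint (K j₀) x) (K j)} := by
    ext x
    simp only [contactSet, mem_ofPred_eq, mem_inter_iff, mem_iInter, mem_preimage,
      Finset.mem_compl]
  rw [this]
  refine MeasurableSet.inter (Finset.measurableSet_biInter _ fun j hj => ?_)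
    (Finset.measurableSet_biInter _ fun j _ => ?_)
  · exact (hm j₀ hj₀ (hJ j hj).compact.measurableSet).inter
      (measurableSet_eq_fun (hm j hj) (hm j₀ hj₀))
  · exact measurableSet_lt measurable_const
      (Metric.continuous_infEDist.measurable.comp (hm j₀ hj₀))

theorem isRayInvariant_contactSet (hJ : ∀ j ∈ J, IsBody (K j)) (hj₀ : j₀ ∈ J) :
    IsRayInvariant (K j₀) (contactSet K J j₀ ρ) := by
  intro x hx s hs
  have h0 := (hJ j₀ hj₀).nearestPoint_add_smul x hs.le
  refine ⟨fun j hj => ?_, fun j hj => ?_⟩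
  · rw [h0]
    refine ⟨(hx.1 j hj).1, ?_⟩
    conv_lhs => rw [← (hx.1 j hj).2]
    rw [(hJ j hj).nearestPoint_add_smul x hs.le, (hx.1 j hj).2]
  · rw [h0]
    exact hx.2 j hj

/-- The points of the contact set at distance exactly `ε` from `K j₀`. -/
def contactSurface {d m : ℕ} (K : Fin m → Set (E d)) (J : Finset (Fin m)) (j₀ : Fin m)
    (ρ ε : ℝ) : Set (E d) :=
  contactSet K J j₀ ρ ∩ {x | dist x (nearestPoint (K j₀) x) = ε}

theorem measurableSet_contactSurface (hJ : ∀ j ∈ J, IsBody (K j)) (hj₀ : j₀ ∈ J) (ε : ℝ) :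
    MeasurableSet (contactSurface K J j₀ ρ ε) := by
  have hc : Continuous fun x => dist x (nearestPoint (K j₀) x) :=
    continuous_id.dist (hJ j₀ hj₀).lipschitz.continuous
  exact (measurableSet_contactSet hJ hj₀).inter
    (measurableSet_eq_fun hc.measurable measurable_const)

/-- `y` is at distance `ε` from a point common to the sets of `J`, and the other sets are more than
`2 * ε` away from that point. -/
theorem mem_cthickening_iff_of_mem_contactSurface {ε : ℝ} (hε : 0 < ε) (hρ : 2 * ε ≤ ρ)
    {y : E d} (hy : y ∈ contactSurface K J j₀ ρ ε) (i : Fin m) :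
    y ∈ Metric.cthickening ε (K i) ↔ i ∈ J := by
  constructor
  · intro h
    by_contra hi
    have h1 := hy.1.2 i hi
    have h2 : Metric.infEDist (nearestPoint (K j₀) y) (K i) ≤
        Metric.infEDist y (K i) + edist (nearestPoint (K j₀) y) y :=
      Metric.infEDist_le_infEDist_add_edist
    have h3 : edist (nearestPoint (K j₀) y) y = ENNReal.ofReal ε := by
      rw [edist_dist, dist_comm, hy.2]
    rw [h3] at h2
    have h4 := h2.trans (add_le_add_left (Metric.mem_cthickening_iff.1 h) _)
    rw [← ENNReal.ofReal_add hε.le hε.le, ← two_mul] at h4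
    exact absurd (h4.trans (ENNReal.ofReal_le_ofReal hρ)) (not_le.2 h1)
  · intro hi
    exact Metric.mem_cthickening_of_dist_le _ _ _ _ (hy.1.1 i hi).1 hy.2.le

theorem iInter_inter_contactSurface_eq_empty {ε : ℝ} (hε : 0 < ε) (hρ : 2 * ε ≤ ρ)
    {I : Finset (Fin m)} (hI : ¬ I ⊆ J) :
    (⋂ i ∈ I, Metric.cthickening ε (K i)) ∩ contactSurface K J j₀ ρ ε = ∅ := by
  rw [eq_empty_iff_forall_notMem]
  rintro y ⟨hyI, hy⟩
  refine hI fun i hi => ?_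
  exact (mem_cthickening_iff_of_mem_contactSurface hε hρ hy i).1 (mem_iInter₂.1 hyI i hi)

/-- The right-hand side does not depend on `I`, so all nonempty `I ⊆ J` contribute the same
curvature. The intersection contains the ball of radius `ε` around `q`, which forces its normals at
`y` to point along `y - q`. -/
theorem localParallelSet_contactSurface (hJ : ∀ j ∈ J, IsBody (K j)) (hj₀ : j₀ ∈ J) {ε η : ℝ}
    (hε : 0 < ε) {I : Finset (Fin m)} (hIJ : I ⊆ J) (hI : I.Nonempty) :
    localParallelSet η (⋂ i ∈ I, Metric.cthickening ε (K i)) (contactSurface K J j₀ ρ ε) =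
      contactSet K J j₀ ρ ∩ {x | ε ≤ dist x (nearestPoint (K j₀) x) ∧
        dist x (nearestPoint (K j₀) x) ≤ ε + η} := by
  have hb := hJ j₀ hj₀
  ext x
  constructor
  · rintro ⟨y, ⟨hyI, hyM, hyε⟩, hmin, hη⟩
    have hyε : dist y (nearestPoint (K j₀) y) = ε := hyε
    set q := nearestPoint (K j₀) y with hq
    have hball : Metric.closedBall q ε ⊆ ⋂ i ∈ I, Metric.cthickening ε (K i) := by
      intro z hz
      exact mem_iInter₂.2 fun i hi => Metric.mem_cthickening_of_dist_le _ _ _ _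
        (hyM.1 i (hIJ hi)).1 hz
    have hinner := IsBody.inner_le_zero_of_forall_dist_le (convex_closedBall q ε)
      (x := x) (y := y) hyε.le fun z hz => hmin z (hball hz)
    set u := y - q with hu
    have hun : ‖u‖ = ε := by rw [hu, ← dist_eq_norm, hyε]
    have hxy : x - y = (‖x - y‖ / ε) • u := by
      rcases eq_or_ne (x - y) 0 with h0 | h0
      · rw [h0]; simp
      have hn : 0 < ‖x - y‖ := norm_pos_iff.2 h0
      -- Tested at the point of the ball farthest in direction `x - y`, the inequality yields
      -- equality in Cauchy–Schwarz.
      have h1 := hinner (q + (ε / ‖x - y‖) • (x - y)) (by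
        rw [Metric.mem_closedBall, dist_eq_norm, add_sub_cancel_left, norm_smul,
          Real.norm_of_nonneg (by positivity), div_mul_cancel₀ _ hn.ne'])
      rw [show q + (ε / ‖x - y‖) • (x - y) - y = (ε / ‖x - y‖) • (x - y) - u by rw [hu]; abel,
        inner_sub_right, inner_smul_right, real_inner_self_eq_norm_sq] at h1
      have h2 : ε / ‖x - y‖ * ‖x - y‖ ^ 2 = ‖x - y‖ * ‖u‖ := by rw [hun]; field_simp
      have h3 := le_antisymm (real_inner_le_norm (x - y) u) (by linarith)
      have h4 := inner_eq_norm_mul_iff_real.1 h3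
      rw [hun] at h4
      rw [div_eq_inv_mul, mul_smul, ← h4, inv_smul_smul₀ hε.ne']
    have hx : x = q + (1 + ‖x - y‖ / ε) • (y - q) := by
      rw [add_smul, one_smul, ← hu, ← hxy, hu]; abel
    have hs : 0 < 1 + ‖x - y‖ / ε := by positivity
    have hpx : nearestPoint (K j₀) x = q := by
      rw [hx, hb.nearestPoint_add_smul y hs.le]
    refine ⟨?_, ?_⟩
    · rw [hx]
      exact isRayInvariant_contactSet hJ hj₀ y hyM _ hs
    · have hd : dist x (nearestPoint (K j₀) x) = ε + dist x y := by
        rw [hpx]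
        conv_lhs => rw [hx]
        rw [dist_eq_norm, add_sub_cancel_left, norm_smul, Real.norm_of_nonneg hs.le, ← hu, hun,
          dist_eq_norm]
        field_simp
      rw [mem_ofPred_eq, hd]
      exact ⟨by linarith [dist_nonneg (x := x) (y := y)], by linarith⟩
  · rintro ⟨hxM, h1, h2⟩
    set q := nearestPoint (K j₀) x with hq
    have hτ : 0 < dist x q := hε.trans_le h1
    have hs : 0 < ε / dist x q := by positivity
    set y := q + (ε / dist x q) • (x - q) with hy
    have hpy : nearestPoint (K j₀) y = q := hb.nearestPoint_add_smul x hs.le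
    have hyq : dist y q = ε := by
      rw [hy, dist_eq_norm, add_sub_cancel_left, norm_smul, Real.norm_of_nonneg hs.le,
        ← dist_eq_norm, div_mul_cancel₀ _ hτ.ne']
    have hxy : dist x y = dist x q - ε := by
      have : x - y = (1 - ε / dist x q) • (x - q) := by rw [hy]; module
      have h0 : 0 ≤ 1 - ε / dist x q := by
        rw [sub_nonneg, div_le_one hτ]; exact h1
      rw [dist_eq_norm, this, norm_smul, Real.norm_of_nonneg h0, ← dist_eq_norm]
      field_simp
    refine ⟨y, ⟨?_, isRayInvariant_contactSet hJ hj₀ x hxM _ hs, ?_⟩, fun z hz => ?_, ?_⟩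
    · exact mem_iInter₂.2 fun i hi => Metric.mem_cthickening_of_dist_le _ _ _ _
        (hxM.1 i (hIJ hi)).1 hyq.le
    · rw [mem_ofPred_eq, hpy, hyq]
    · obtain ⟨i, hi⟩ := hI
      have hbi := hJ i (hIJ hi)
      have hz' := (hbi.dist_le_iff_mem_cthickening hε.le).2 (mem_iInter₂.1 hz i hi)
      have h3 := (hbi.nearestPoint_spec x).2 _ (hbi.nearestPoint_mem z)
      rw [(hxM.1 i (hIJ hi)).2] at h3
      have h4 := dist_triangle x z (nearestPoint (K i) z)
      rw [hxy]
      linarith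
    · rw [hxy]; linarith

open Polynomial in
/-- On the contact surface the curvature measure of the parallel set is the one of a single
convex parallel body, and it is given by the Taylor coefficients of the shell polynomial. -/
theorem IsConvexRepr.curvature_contactSurface {A : Set (E d)} (h : IsConvexRepr A m K)
    (hJ : ∀ j ∈ J, IsBody (K j)) (hj₀ : j₀ ∈ J) {G : ℝ[X]} (hG : G.natDegree ≤ d)
    (hGe : ∀ s : ℝ, 0 < s → (volume (shell (K j₀) (contactSet K J j₀ ρ) s)).toReal = G.eval s)
    {ε : ℝ} (hε : 0 < ε) (hρ : 2 * ε ≤ ρ) (k : Fin d) :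
    curvature k.castSucc (Metric.cthickening ε A) (contactSurface K J j₀ ρ ε) =
      (taylor ε G).coeff (d - k) / unitBallVolume (d - k) := by
  classical
  have hb := hJ j₀ hj₀
  set M := contactSet K J j₀ ρ with hM
  set Y := contactSurface K J j₀ ρ ε with hY
  have hYm : MeasurableSet Y := measurableSet_contactSurface hJ hj₀ ε
  have hMm : MeasurableSet M := measurableSet_contactSet hJ hj₀
  set v := (taylor ε G).coeff (d - k) / unitBallVolume (d - k) with hv
  -- The region between distances `ε` and `ε + η` includes `Y`, which the difference of two shells
  -- omits. The correction is constant and does not affect the coefficient of degree `d - k > 0`.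
  set Q : ℝ[X] := taylor ε G + C ((volume Y).toReal - G.eval ε) with hQ
  have hQdeg : Q.natDegree ≤ d :=
    (natDegree_add_le _ _).trans (by simpa [natDegree_taylor] using hG)
  have hvol : ∀ η : ℝ, 0 < η → (volume (M ∩ {x | ε ≤ dist x (nearestPoint (K j₀) x) ∧
      dist x (nearestPoint (K j₀) x) ≤ ε + η})).toReal = Q.eval η := by
    intro η hη
    set S := M ∩ {x | ε ≤ dist x (nearestPoint (K j₀) x) ∧
      dist x (nearestPoint (K j₀) x) ≤ ε + η}
    have hYfin : volume Y ≠ ⊤ := by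
      refine ((measure_mono ?_).trans_lt (hb.volume_shell_lt_top M ε)).ne
      rintro x ⟨hx, hxε⟩
      have hxε : dist x (nearestPoint (K j₀) x) = ε := hxε
      exact ⟨hx, by rw [hxε]; exact hε, hxε.le⟩
    have hunion : shell (K j₀) M (ε + η) ∪ Y = shell (K j₀) M ε ∪ S := by
      ext x
      simp only [shell, hY, contactSurface, S, mem_union, mem_inter_iff, mem_ofPred_eq, ← hM]
      constructor
      · rintro (⟨h1, h2, h3⟩ | ⟨h1, h2⟩)
        · rcases le_total (dist x (nearestPoint (K j₀) x)) ε with h4 | h4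
          · exact Or.inl ⟨h1, h2, h4⟩
          · exact Or.inr ⟨h1, h4, h3⟩
        · exact Or.inr ⟨h1, h2.ge, by linarith⟩
      · rintro (⟨h1, h2, h3⟩ | ⟨h1, h2, h3⟩)
        · exact Or.inl ⟨h1, h2, by linarith⟩
        · exact Or.inl ⟨h1, by linarith, h3⟩
    have hinter : shell (K j₀) M (ε + η) ∩ Y = shell (K j₀) M ε ∩ S := by
      ext x
      simp only [shell, hY, contactSurface, S, mem_inter_iff, mem_ofPred_eq, ← hM]
      constructor
      · rintro ⟨⟨h1, h2, h3⟩, -, h4⟩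
        exact ⟨⟨h1, h2, h4.le⟩, h1, h4.ge, h3⟩
      · rintro ⟨⟨h1, h2, h3⟩, -, h4, h5⟩
        exact ⟨⟨h1, h2, h5⟩, h1, le_antisymm h3 h4⟩
    have hSfin : volume S ≠ ⊤ := by
      refine ((measure_mono ?_).trans_lt (hb.volume_shell_lt_top M (ε + η))).ne
      rintro x ⟨hx, h1, h2⟩
      exact ⟨hx, hε.trans_le h1, h2⟩
    have hSm : MeasurableSet S := by
      have hc : Continuous fun x => dist x (nearestPoint (K j₀) x) :=
        continuous_id.dist hb.lipschitz.continuous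
      exact hMm.inter ((measurableSet_le measurable_const hc.measurable).inter
        (measurableSet_le hc.measurable measurable_const))
    have e1 := measure_union_add_inter (μ := volume) (shell (K j₀) M (ε + η)) hYm
    have e2 := measure_union_add_inter (μ := volume) (shell (K j₀) M ε) hSm
    rw [hunion, hinter, e2] at e1
    have e3 := congrArg ENNReal.toReal e1
    rw [ENNReal.toReal_add (hb.volume_shell_lt_top _ _).ne hSfin,
      ENNReal.toReal_add (hb.volume_shell_lt_top _ _).ne hYfin, hGe ε hε,
      hGe (ε + η) (by linarith)] at e3
    rw [hQ, eval_add, eval_C, taylor_eval, add_comm η ε]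
    linarith
  have hcc : ∀ I : Finset (Fin m), I.Nonempty → convexCurvature k.castSucc
      (⋂ i ∈ I, Metric.cthickening ε (K i)) Y = if I ⊆ J then v else 0 := by
    intro I hI
    split_ifs with hIJ
    · rw [convexCurvature_eq_coeff hQdeg fun η hη => by
        rw [localParallelSet_contactSurface hJ hj₀ hε hIJ hI]; exact hvol η hη]
      have hk : d - (k : ℕ) ≠ 0 := by have := k.2; omega
      simp only [hQ, hv, Fin.val_castSucc, coeff_add, coeff_C, if_neg hk, add_zero]
    · exact convexCurvature_eq_zero (iInter_inter_contactSurface_eq_empty hε hρ hIJ) _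
  rw [(h.cthickening ε).curvature_eq hYm]
  rcases Y.eq_empty_or_nonempty with hYe | ⟨y, hy⟩
  · have hv0 : v = 0 := by
      have := hcc {j₀} (Finset.singleton_nonempty _)
      rw [if_pos (by simpa using hj₀), hYe, convexCurvature_eq_zero (by simp)] at this
      exact this.symm
    rw [hv0]
    exact Finset.sum_eq_zero fun I hI => by
      rw [hYe, convexCurvature_eq_zero (by simp), mul_zero]
  · have hsum := (h.cthickening ε).sum_ite_mem y
    have hyA : y ∈ Metric.cthickening ε A := by
      rw [(h.cthickening ε).2]
      exact mem_iUnion.2 ⟨j₀, (mem_cthickening_iff_of_mem_contactSurface hε hρ hy j₀).2 hj₀⟩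
    rw [if_pos hyA] at hsum
    -- Each term is `v` times the indicator at a single point `y ∈ Y`, and the signed indicators sum
    -- to `1` because `y ∈ A_ε`.
    calc _ = ∑ I : Finset (Fin m) with I.Nonempty,
          (if y ∈ ⋂ i ∈ I, Metric.cthickening ε (K i) then (-1 : ℝ) ^ (I.card - 1) else 0) * v := by
          refine Finset.sum_congr rfl fun I hI => ?_
          rw [hcc I (Finset.mem_filter.1 hI).2]
          have : y ∈ ⋂ i ∈ I, Metric.cthickening ε (K i) ↔ I ⊆ J := by
            rw [mem_iInter₂]
            exact forall₂_congr fun i _ => mem_cthickening_iff_of_mem_contactSurface hε hρ hy i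
          by_cases hIJ : I ⊆ J
          · rw [if_pos hIJ, if_pos (this.2 hIJ)]
          · rw [if_neg hIJ, if_neg (this.not.2 hIJ)]; ring
      _ = v := by rw [← Finset.sum_mul, hsum, one_mul]

-- The variation dominates the curvature of the contact surface, which tends to `G.coeff (d - k) /
-- κ_{d-k} > 0` as the Taylor centre `ε` tends to `0`.
open Polynomial in
theorem IsConvexRepr.not_tendsto_curvatureVar {A : Set (E d)} (h : IsConvexRepr A m K)
    (hJ : ∀ j ∈ J, IsBody (K j)) (hj₀ : j₀ ∈ J) (hρ : 0 < ρ) {G : ℝ[X]} (hG : G.natDegree ≤ d)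
    (hGe : ∀ s : ℝ, 0 < s → (volume (shell (K j₀) (contactSet K J j₀ ρ) s)).toReal = G.eval s)
    {k : Fin d} (hpos : 0 < G.coeff (d - k)) :
    ¬ Tendsto (fun ε : ℝ => curvatureVar k.castSucc (Metric.cthickening ε A)) (𝓝[>] 0) (𝓝 0) := by
  intro hlim
  obtain ⟨c, hc⟩ := h.exists_curvature_bound k.castSucc
  have h1 : Tendsto (fun ε : ℝ => (taylor ε G).coeff (d - k) / unitBallVolume (d - k)) (𝓝[>] 0)
      (𝓝 (G.coeff (d - k) / unitBallVolume (d - k))) := by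
    refine Tendsto.div_const ?_ _
    simp only [taylor_coeff]
    have := ((hasseDeriv (d - k) G).continuous.tendsto 0).mono_left
      (nhdsWithin_le_nhds (s := Ioi (0 : ℝ)))
    rwa [← taylor_coeff, taylor_zero] at this
  have h2 := le_of_tendsto_of_tendsto h1 hlim ?_
  · exact absurd h2 (not_le.2 (div_pos hpos (unitBallVolume_pos _)))
  · filter_upwards [Ioo_mem_nhdsGT (zero_lt_one' ℝ), Ioo_mem_nhdsGT (half_pos hρ)] with ε h3 h4
    have h5 : 2 * ε ≤ ρ := by linarith [h4.2]
    rw [← h.curvature_contactSurface hJ hj₀ hG hGe h3.1 h5 k]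
    exact (le_abs_self _).trans (abs_curvature_le_curvatureVar (hc ε h3.2.le)
      (measurableSet_contactSurface hJ hj₀ ε))

end

/-! ### Orthogonal splittings and a Sard argument. -/

/-- `P` and `Q` are complementary orthogonal projections. -/
structure IsSplitting {d : ℕ} (P Q : E d →L[ℝ] E d) : Prop where
  add_apply : ∀ x, P x + Q x = x
  idem : ∀ x, P (P x) = P x
  inner_left : ∀ x y, inner ℝ (P x) y = inner ℝ x (P y)

namespace IsSplitting

variable {d : ℕ} {P Q : E d →L[ℝ] E d}

theorem apply_comp_zero (h : IsSplitting P Q) (x : E d) : P (Q x) = 0 := by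
  have := congrArg P (h.add_apply x)
  rw [map_add, h.idem] at this
  simpa using this

theorem comp_apply_zero (h : IsSplitting P Q) (x : E d) : Q (P x) = 0 := by
  have := h.add_apply (P x)
  rw [h.idem] at this
  simpa using this

theorem idem_right (h : IsSplitting P Q) (x : E d) : Q (Q x) = Q x := by
  have := h.add_apply (Q x)
  rw [h.apply_comp_zero] at this
  simpa using this

end IsSplitting

theorem exists_isSplitting {d k : ℕ} (hk : k ≤ d) : ∃ P Q : E d →L[ℝ] E d, IsSplitting P Q ∧
    Module.finrank ℝ (LinearMap.range P.toLinearMap) = k ∧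
    Module.finrank ℝ (LinearMap.range Q.toLinearMap) = d - k := by
  set b := EuclideanSpace.basisFun (Fin d) ℝ
  have hli : LinearIndependent ℝ fun i : Fin k => b (Fin.castLE hk i) :=
    b.orthonormal.linearIndependent.comp _ (Fin.castLE_injective hk)
  set W := Submodule.span ℝ (range fun i : Fin k => b (Fin.castLE hk i))
  have hW : Module.finrank ℝ W = k := by
    rw [finrank_span_eq_card hli, Fintype.card_fin]
  have hWo := W.finrank_add_finrank_orthogonal
  rw [hW, finrank_euclideanSpace_fin] at hWo
  refine ⟨W.starProjection, Wᗮ.starProjection, ⟨fun x => ?_, fun x => ?_, fun x y => ?_⟩, ?_, ?_⟩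
  · exact W.starProjection_add_starProjection_orthogonal x
  · exact Submodule.starProjection_eq_self_iff.2 (W.starProjection_apply_mem x)
  · exact W.inner_starProjection_left_eq_right x y
  · rw [Submodule.range_starProjection, hW]
  · rw [Submodule.range_starProjection]
    exact (Nat.sub_eq_of_eq_add' hWo.symm).symm

theorem finrank_range_comp_le {d : ℕ} (f g : E d →ₗ[ℝ] E d) :
    Module.finrank ℝ (LinearMap.range (f ∘ₗ g)) ≤ Module.finrank ℝ (LinearMap.range g) := by
  rw [LinearMap.range_comp]
  exact Submodule.finrank_map_le _ _

/-- Composing the surjective map with `P` leaves `P ∘ D`, so the rank of `P` is at most that of `D`;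
likewise for `Q`. -/
theorem IsSplitting.finrank_le_of_det_ne_zero {d : ℕ} {P Q : E d →L[ℝ] E d} (h : IsSplitting P Q)
    {D D' : E d →L[ℝ] E d} (hdet : (P.comp D + Q.comp D').det ≠ 0) :
    Module.finrank ℝ (LinearMap.range P.toLinearMap) ≤
        Module.finrank ℝ (LinearMap.range D.toLinearMap) ∧
      Module.finrank ℝ (LinearMap.range Q.toLinearMap) ≤
        Module.finrank ℝ (LinearMap.range D'.toLinearMap) := by
  set T := P.comp D + Q.comp D' with hT
  have hsurj : Function.Surjective T := by
    have := (LinearMap.equivOfDetNeZero T.toLinearMap hdet).surjective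
    exact this
  constructor
  · refine (Submodule.finrank_mono ?_).trans (finrank_range_comp_le P.toLinearMap D.toLinearMap)
    rintro _ ⟨v, rfl⟩
    obtain ⟨w, hw⟩ := hsurj (P v)
    refine ⟨w, ?_⟩
    have := congrArg P hw
    rw [hT] at this
    simp only [_root_.add_apply, ContinuousLinearMap.comp_apply, map_add, h.idem,
      h.apply_comp_zero, add_zero] at this
    exact this
  · refine (Submodule.finrank_mono ?_).trans (finrank_range_comp_le Q.toLinearMap D'.toLinearMap)
    rintro _ ⟨v, rfl⟩
    obtain ⟨w, hw⟩ := hsurj (Q v)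
    refine ⟨w, ?_⟩
    have := congrArg Q hw
    rw [hT] at this
    simp only [_root_.add_apply, ContinuousLinearMap.comp_apply, map_add,
      h.idem_right, h.comp_apply_zero, zero_add] at this
    exact this

/-- The image of a set under `x ↦ P (p x) + Q (x - p x)` is null if the set of its points where the
differential of the nearest point map `p` has the right ranks is null. -/
theorem IsSplitting.volume_image_eq_zero {d : ℕ} {P Q : E d →L[ℝ] E d} (h : IsSplitting P Q)
    {K : Set (E d)} (hK : IsBody K) {S : Set (E d)}
    (hS : volume (S ∩ {x | DifferentiableAt ℝ (nearestPoint K) x ∧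
      Module.finrank ℝ (LinearMap.range P.toLinearMap) ≤
        Module.finrank ℝ (LinearMap.range (fderiv ℝ (nearestPoint K) x).toLinearMap) ∧
      Module.finrank ℝ (LinearMap.range Q.toLinearMap) ≤ Module.finrank ℝ (LinearMap.range
        (ContinuousLinearMap.id ℝ (E d) - fderiv ℝ (nearestPoint K) x).toLinearMap)}) = 0) :
    volume ((fun x => P (nearestPoint K x) + Q (x - nearestPoint K x)) '' S) = 0 := by
  set p := nearestPoint K
  set Φ : E d → E d := fun x => P (p x) + Q (x - p x)
  have hΦ : LipschitzWith (‖P‖₊ * 1 + ‖Q‖₊ * (1 + 1)) Φ :=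
    (P.lipschitz.comp hK.lipschitz).add
      (Q.lipschitz.comp ((LipschitzWith.id (α := E d)).sub hK.lipschitz))
  set S₁ := S ∩ {x | DifferentiableAt ℝ p x ∧
      Module.finrank ℝ (LinearMap.range P.toLinearMap) ≤
        Module.finrank ℝ (LinearMap.range (fderiv ℝ p x).toLinearMap) ∧
      Module.finrank ℝ (LinearMap.range Q.toLinearMap) ≤ Module.finrank ℝ (LinearMap.range
        (ContinuousLinearMap.id ℝ (E d) - fderiv ℝ p x).toLinearMap)}
  set N := {x | ¬ DifferentiableAt ℝ p x}
  have hN : volume N = 0 := hK.lipschitz.ae_differentiableAt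
  -- Here the differential of `Φ` exists but is singular, since an invertible one would imply the
  -- rank conditions.
  have h3 : volume (Φ '' (S \ (S₁ ∪ N))) = 0 := by
    refine addHaar_image_eq_zero_of_det_fderivWithin_eq_zero
      (f' := fun x => P.comp (fderiv ℝ p x) +
        Q.comp (ContinuousLinearMap.id ℝ (E d) - fderiv ℝ p x)) volume (fun x hx => ?_)
      fun x hx => ?_
    · have hx' : DifferentiableAt ℝ p x := by
        by_contra hcon
        exact hx.2 (Or.inr hcon)
      have hd := hx'.hasFDerivAt
      exact ((P.hasFDerivAt.comp x hd).add
        (Q.hasFDerivAt.comp x ((hasFDerivAt_id x).sub hd))).hasFDerivWithinAt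
    · by_contra hdet
      have hx' : DifferentiableAt ℝ p x := by
        by_contra hcon
        exact hx.2 (Or.inr hcon)
      exact hx.2 (Or.inl ⟨hx.1, hx', h.finrank_le_of_det_ne_zero hdet⟩)
  refine measure_mono_null (t := Φ '' S₁ ∪ Φ '' N ∪ Φ '' (S \ (S₁ ∪ N))) ?_ ?_
  · rw [← image_union, ← image_union]
    exact image_mono fun x hx => by
      by_cases hx' : x ∈ S₁ ∪ N
      · exact Or.inl hx'
      · exact Or.inr ⟨hx, hx'⟩
  · exact measure_union_null (measure_union_null (volume_image_eq_zero_of_lipschitz hΦ hS)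
      (volume_image_eq_zero_of_lipschitz hΦ hN)) h3

/-! ### Common normals from penalized slice support functions. -/

/-- The support function of the slices of `A` parallel to the range of `Q`, penalized with slope
`L` in the complementary directions. -/
noncomputable def sliceSupport {d : ℕ} (P Q : E d →L[ℝ] E d) (A : Set (E d)) (L : ℕ) (z : E d) :
    ℝ :=
  sSup ((fun q => inner ℝ (Q z) q - L * ‖P q - P z‖) '' A)

section

variable {d : ℕ} {P Q : E d →L[ℝ] E d} {A : Set (E d)}

theorem le_sliceSupport (hA : IsCompact A) (L : ℕ) (z : E d) {q : E d} (hq : q ∈ A) :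
    inner ℝ (Q z) q - L * ‖P q - P z‖ ≤ sliceSupport P Q A L z :=
  le_csSup (hA.image (by fun_prop)).bddAbove (mem_image_of_mem _ hq)

theorem exists_eq_sliceSupport (hA : IsCompact A) (hne : A.Nonempty) (L : ℕ) (z : E d) :
    ∃ q ∈ A, inner ℝ (Q z) q - L * ‖P q - P z‖ = sliceSupport P Q A L z :=
  (hA.image (f := fun q => inner ℝ (Q z) q - L * ‖P q - P z‖) (by fun_prop)).sSup_mem
    (hne.image _)

theorem exists_lipschitz_sliceSupport (hA : IsCompact A) (hne : A.Nonempty) (L : ℕ) :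
    ∃ C, LipschitzWith C (sliceSupport P Q A L) := by
  obtain ⟨R, hR⟩ := hA.isBounded.exists_norm_le
  have hR0 : 0 ≤ R := (norm_nonneg _).trans (hR _ hne.some_mem)
  refine ⟨⟨‖Q‖ * R + L * ‖P‖, by positivity⟩, LipschitzWith.of_le_add_mul _ fun x y => ?_⟩
  obtain ⟨q, hq, hqx⟩ := exists_eq_sliceSupport (P := P) (Q := Q) hA hne L x
  have hy := le_sliceSupport (P := P) (Q := Q) hA L y hq
  rw [← hqx]
  have h1 : inner ℝ (Q x) q - inner ℝ (Q y) q ≤ ‖Q‖ * R * dist x y := by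
    rw [← inner_sub_left, ← map_sub]
    refine (real_inner_le_norm _ _).trans ?_
    calc ‖Q (x - y)‖ * ‖q‖ ≤ (‖Q‖ * ‖x - y‖) * R := by
          gcongr
          · exact Q.le_opNorm _
          · exact hR q hq
      _ = _ := by rw [dist_eq_norm]; ring
  have h2 : ‖P q - P y‖ - ‖P q - P x‖ ≤ ‖P‖ * dist x y := by
    refine (norm_sub_norm_le _ _).trans ?_
    rw [sub_sub_sub_cancel_left, ← map_sub, dist_eq_norm]
    exact P.le_opNorm _
  have h3 : (L : ℝ) * (‖P q - P y‖ - ‖P q - P x‖) ≤ L * (‖P‖ * dist x y) := by gcongr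
  change _ ≤ _ + (‖Q‖ * R + L * ‖P‖) * dist x y
  nlinarith

/-- Away from the boundary of the projection of the convex set `K`, the penalization is exact for
large slopes. -/
theorem IsSplitting.eventually_inner_sub_le (h : IsSplitting P Q) {K : Set (E d)}
    (hK : IsCompact K ∧ Convex ℝ K) {z : E d} (hz : z ∉ frontier (P ⁻¹' (P '' K))) {f : ℝ}
    (hf : ∀ q ∈ K, P q = P z → inner ℝ (Q z) q ≤ f) :
    ∀ᶠ L : ℕ in atTop, ∀ q ∈ K, inner ℝ (Q z) q - L * ‖P q - P z‖ ≤ f := by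
  set v := Q z
  obtain ⟨R, hR⟩ := hK.1.isBounded.exists_norm_le
  have hcl : IsClosed (P ⁻¹' (P '' K)) :=
    (hK.1.image P.continuous).isClosed.preimage P.continuous
  by_cases hzC : z ∈ P ⁻¹' (P '' K)
  · have hint : z ∈ interior (P ⁻¹' (P '' K)) := by
      by_contra hcon
      exact hz ⟨subset_closure hzC, hcon⟩
    obtain ⟨δ, hδ, hball⟩ := Metric.mem_nhds_iff.1 (mem_interior_iff_mem_nhds.1 hint)
    filter_upwards [eventually_ge_atTop ⌈(2 / δ) * (f + ‖v‖ * R)⌉₊] with L hL q hq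
    have hL' : (2 / δ) * (f + ‖v‖ * R) ≤ L := (Nat.le_ceil _).trans (by exact_mod_cast hL)
    set w := P q - P z with hw
    rcases eq_or_ne w 0 with h0 | h0
    · rw [h0, norm_zero, mul_zero, sub_zero]
      exact hf q hq (sub_eq_zero.1 h0)
    have hθ : 0 < ‖w‖ := norm_pos_iff.2 h0
    have hPw : P w = w := by rw [hw, map_sub, h.idem, h.idem]
    -- `q'` lies on the other side of `P z` from `q`, so the segment between them crosses the slice,
    -- where the value is at most `f`. With `⟨v, q'⟩ ≥ -‖v‖ R` this bounds `⟨v, q⟩` by `f + L ‖w‖`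
    -- for the chosen threshold.
    obtain ⟨q', hq', hPq'⟩ : z - (δ / 2 / ‖w‖) • w ∈ P ⁻¹' (P '' K) := hball (by
      rw [Metric.mem_ball, dist_eq_norm, sub_sub_cancel_left, norm_neg, norm_smul,
        Real.norm_of_nonneg (by positivity), div_mul_cancel₀ _ hθ.ne']
      linarith)
    rw [map_sub, map_smul, hPw] at hPq'
    have hs : 0 < δ / 2 + ‖w‖ := by positivity
    have hconv : ((δ / 2) / (δ / 2 + ‖w‖)) • q + (‖w‖ / (δ / 2 + ‖w‖)) • q' ∈ K :=
      hK.2 hq hq' (by positivity) (by positivity) (by field_simp)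
    have hP : P (((δ / 2) / (δ / 2 + ‖w‖)) • q + (‖w‖ / (δ / 2 + ‖w‖)) • q') = P z := by
      have hPq : P q = P z + w := by rw [hw]; abel
      rw [map_add, map_smul, map_smul, hPq', hPq]
      have e : ((δ / 2) / (δ / 2 + ‖w‖)) • (P z + w) +
          (‖w‖ / (δ / 2 + ‖w‖)) • (P z - (δ / 2 / ‖w‖) • w) =
          ((δ / 2) / (δ / 2 + ‖w‖) + ‖w‖ / (δ / 2 + ‖w‖)) • P z +
          ((δ / 2) / (δ / 2 + ‖w‖) - ‖w‖ / (δ / 2 + ‖w‖) * (δ / 2 / ‖w‖)) • w := by module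
      rw [e, show (δ / 2) / (δ / 2 + ‖w‖) + ‖w‖ / (δ / 2 + ‖w‖) = 1 by field_simp,
        show (δ / 2) / (δ / 2 + ‖w‖) - ‖w‖ / (δ / 2 + ‖w‖) * (δ / 2 / ‖w‖) = 0 by
          field_simp; ring]
      simp
    have h1 := hf _ hconv hP
    rw [inner_add_right, inner_smul_right, inner_smul_right,
      show δ / 2 / (δ / 2 + ‖w‖) * inner ℝ v q + ‖w‖ / (δ / 2 + ‖w‖) * inner ℝ v q' =
        (δ / 2 * inner ℝ v q + ‖w‖ * inner ℝ v q') / (δ / 2 + ‖w‖) by ring,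
      div_le_iff₀ hs] at h1
    have h2 : -(‖v‖ * R) ≤ inner ℝ v q' := by
      have := neg_le_of_abs_le (abs_real_inner_le_norm v q')
      have h3 : ‖v‖ * ‖q'‖ ≤ ‖v‖ * R := by gcongr; exact hR q' hq'
      linarith
    have h4 : (2 / δ) * (f + ‖v‖ * R) * ‖w‖ ≤ L * ‖w‖ := by gcongr
    have h5 : (δ / 2) * ((2 / δ) * (f + ‖v‖ * R) * ‖w‖) = (f + ‖v‖ * R) * ‖w‖ := by field_simp
    have h6 : (δ / 2) * (inner ℝ v q - L * ‖w‖) ≤ (δ / 2) * f := by nlinarith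
    exact le_of_mul_le_mul_left h6 (by positivity)
  · obtain ⟨δ, hδ, hball⟩ := Metric.isOpen_iff.1 hcl.isOpen_compl z hzC
    filter_upwards [eventually_ge_atTop ⌈(‖v‖ * R - f) / δ⌉₊] with L hL q hq
    have hL' : (‖v‖ * R - f) / δ ≤ L := (Nat.le_ceil _).trans (by exact_mod_cast hL)
    -- The slice is empty, and the penalty of at least `L * δ` outweighs the bound `‖v‖ * R`.
    have hw : δ ≤ ‖P q - P z‖ := by
      by_contra! hlt
      refine hball (a := z + (P q - P z)) ?_ ⟨q, hq, ?_⟩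
      · rwa [Metric.mem_ball, dist_eq_norm, add_sub_cancel_left]
      · rw [map_add, map_sub, h.idem, h.idem]; abel
    have h1 : inner ℝ v q ≤ ‖v‖ * R :=
      (real_inner_le_norm _ _).trans (by gcongr; exact hR q hq)
    have h2 : (L : ℝ) * δ ≤ L * ‖P q - P z‖ := by gcongr
    have h3 := (div_le_iff₀ hδ).1 hL'
    linarith

end

section

variable {d m : ℕ} {P Q : E d →L[ℝ] E d} {A : Set (E d)} {K : Fin m → Set (E d)}

/-- At a point of differentiability of the slice support function, the maximizing point has a
common normal for all sets `K i` that contain it. -/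
theorem IsSplitting.exists_common_normal (h : IsSplitting P Q) (hA : IsConvexRepr A m K) {L : ℕ}
    {z q : E d} (hdiff : DifferentiableAt ℝ (sliceSupport P Q A L) z) (hPq : P q = P z)
    (hmax : sliceSupport P Q A L z = inner ℝ (Q z) q) :
    ∃ u, Q u = Q z ∧ ∀ i, q ∈ K i → ∀ q' ∈ K i, inner ℝ u (q' - q) ≤ 0 := by
  set S := sliceSupport P Q A L
  set a := (InnerProductSpace.toDual ℝ (E d)).symm (fderiv ℝ S z)
  refine ⟨Q z - P a, by rw [map_sub, h.idem_right, h.comp_apply_zero, sub_zero], ?_⟩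
  intro i hi q' hq'
  set w := P (q' - q) with hw
  have hPw : P w = w := h.idem _
  have hQw : Q w = 0 := h.comp_apply_zero _
  have hline : HasDerivAt (fun t : ℝ => S (z + t • w)) (fderiv ℝ S z w) 0 :=
    hdiff.hasFDerivAt.hasLineDerivAt w
  have hslope := hline.tendsto_slope_zero_right
  simp only [zero_add, zero_smul, add_zero] at hslope
  -- When `z` moves to `z + t • w`, the point `q + t • (q' - q)` stays in the moving slice and has
  -- no penalty, so it bounds `S` from below.
  have hge : inner ℝ (Q z) (q' - q) ≤ fderiv ℝ S z w := by
    refine ge_of_tendsto hslope ?_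
    filter_upwards [Ioo_mem_nhdsGT (zero_lt_one' ℝ)] with t ht
    have hmem : q + t • (q' - q) ∈ A := by
      rw [hA.2]
      refine mem_iUnion.2 ⟨i, ?_⟩
      have : (1 - t) • q + t • q' ∈ K i :=
        (hA.1 i).2 hi hq' (by linarith [ht.2]) ht.1.le (by ring)
      rwa [show q + t • (q' - q) = (1 - t) • q + t • q' by module]
    have h1 := le_sliceSupport (P := P) (Q := Q) hA.isCompact L (z + t • w) hmem
    rw [map_add, map_smul, hQw, smul_zero, add_zero, map_add, map_smul, ← hw, map_add, map_smul,
      hPw, hPq, sub_self, norm_zero, mul_zero, sub_zero, inner_add_right, inner_smul_right,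
      ← hmax] at h1
    rw [smul_eq_mul, ← div_eq_inv_mul, le_div_iff₀ ht.1]
    linarith
  have hg : fderiv ℝ S z w = inner ℝ (P a) (q' - q) := by
    rw [h.inner_left, ← hw, InnerProductSpace.toDual_symm_apply]
  rw [inner_sub_left]
  linarith

/-- With `q` maximizing `⟨Q z, ·⟩` on the slice of `A` through `z`, and `u` the common normal there,
`x = q + u` has nearest point `q` in every `K j` containing `q`, and its image is `P q + Q u = P z +
Q z = z`. -/
theorem ae_exists_mem_contactSet (h : IsSplitting P Q) (hA : IsConvexRepr A m K)
    (hQ : LinearMap.ker Q.toLinearMap ≠ ⊤) (i₀ : Fin m) :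
    ∀ᵐ z, z ∈ K i₀ → ∃ (J : Finset (Fin m)) (j₀ : Fin m) (n : ℕ),
      (j₀ ∈ J ∧ ∀ j ∈ J, IsBody (K j)) ∧
      z ∈ (fun x => P (nearestPoint (K j₀) x) + Q (x - nearestPoint (K j₀) x)) ''
        shell (K j₀) (contactSet K J j₀ (1 / ((n : ℝ) + 1))) ((n : ℝ) + 1) := by
  classical
  rcases A.eq_empty_or_nonempty with hAe | hAne
  · refine Eventually.of_forall fun z hz => ?_
    have : z ∈ A := hA.2 ▸ mem_iUnion.2 ⟨i₀, hz⟩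
    rw [hAe] at this
    exact absurd this (notMem_empty z)
  have hAc := hA.isCompact
  have hae1 : ∀ᵐ z, ∀ L : ℕ, DifferentiableAt ℝ (sliceSupport P Q A L) z := by
    rw [ae_all_iff]
    intro L
    obtain ⟨C, hC⟩ := exists_lipschitz_sliceSupport (P := P) (Q := Q) hAc hAne L
    exact hC.ae_differentiableAt
  have hae2 : ∀ᵐ z : E d, ∀ i, z ∉ frontier (P ⁻¹' (P '' K i)) := by
    rw [ae_all_iff]
    intro i
    have hconv : Convex ℝ (P ⁻¹' (P '' K i)) :=
      ((hA.1 i).2.linear_image P.toLinearMap).linear_preimage P.toLinearMap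
    exact measure_eq_zero_iff_ae_notMem.1 (hconv.addHaar_frontier volume)
  have hae3 : ∀ᵐ z : E d, Q z ≠ 0 := by
    have := measure_eq_zero_iff_ae_notMem.1 (Measure.addHaar_submodule volume _ hQ)
    filter_upwards [this] with z hz h0
    exact hz h0
  filter_upwards [hae1, hae2, hae3] with z hz1 hz2 hz3 hzK
  have hzA : z ∈ A := hA.2 ▸ mem_iUnion.2 ⟨i₀, hzK⟩
  have hfib : IsCompact (A ∩ {q | P q = P z}) :=
    hAc.inter_right (isClosed_eq P.continuous continuous_const)
  obtain ⟨q, ⟨hqA, hPq⟩, hqmax⟩ := hfib.exists_isMaxOn ⟨z, hzA, rfl⟩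
    (f := fun q => inner ℝ (Q z) q) (by fun_prop)
  have hPq : P q = P z := hPq
  have hsub : ∀ i, K i ⊆ A := fun i => by rw [hA.2]; exact subset_iUnion K i
  have hev : ∀ᶠ L : ℕ in atTop, ∀ i, ∀ q' ∈ K i,
      inner ℝ (Q z) q' - L * ‖P q' - P z‖ ≤ inner ℝ (Q z) q := by
    rw [eventually_all]
    exact fun i => h.eventually_inner_sub_le (hA.1 i) (hz2 i) fun q' hq' hP' =>
      hqmax ⟨hsub i hq', hP'⟩
  obtain ⟨L, hL⟩ := hev.exists
  have hmax : sliceSupport P Q A L z = inner ℝ (Q z) q := by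
    refine le_antisymm ?_ ?_
    · obtain ⟨q', hq', he⟩ := exists_eq_sliceSupport (P := P) (Q := Q) hAc hAne L z
      rw [← he]
      rw [hA.2] at hq'
      obtain ⟨i, hi⟩ := mem_iUnion.1 hq'
      exact hL i q' hi
    · have := le_sliceSupport (P := P) (Q := Q) hAc L z hqA
      rwa [hPq, sub_self, norm_zero, mul_zero, sub_zero] at this
  obtain ⟨u, hu, hnormal⟩ := h.exists_common_normal hA (hz1 L) hPq hmax
  -- A shell contains only points at positive distance, hence the restriction to `Q z ≠ 0`.
  have hu0 : u ≠ 0 := fun h0 => hz3 (by rw [← hu, h0, map_zero])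
  set J : Finset (Fin m) := Finset.univ.filter fun i => q ∈ K i with hJ
  have hmemJ : ∀ i, i ∈ J ↔ q ∈ K i := fun i => by simp [hJ]
  obtain ⟨j₀, hj₀⟩ : ∃ j₀, q ∈ K j₀ := mem_iUnion.1 (hA.2 ▸ hqA)
  have hbody : ∀ j, q ∈ K j → IsBody (K j) := fun j hj => ⟨(hA.1 j).1, (hA.1 j).2, q, hj⟩
  have hnear : ∀ j, q ∈ K j → nearestPoint (K j) (q + u) = q := fun j hj =>
    (hbody j hj).nearestPoint_eq_of_inner hj fun q' hq' => by
      rw [add_sub_cancel_left]; exact hnormal j hj q' hq'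
  have hfar : ∀ᶠ n : ℕ in atTop, ∀ j, q ∉ K j →
      ENNReal.ofReal (1 / ((n : ℝ) + 1)) < Metric.infEDist q (K j) := by
    rw [eventually_all]
    intro j
    by_cases hj : q ∈ K j
    · exact Eventually.of_forall fun _ hn => absurd hj hn
    · have hpos : 0 < Metric.infEDist q (K j) := by
        rw [pos_iff_ne_zero]
        intro h0
        exact hj ((Metric.mem_iff_infEDist_zero_of_closed (hA.1 j).1.isClosed).2 h0)
      have hlim : Tendsto (fun n : ℕ => ENNReal.ofReal (1 / ((n : ℝ) + 1))) atTop (𝓝 0) := by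
        have := ENNReal.tendsto_ofReal (tendsto_one_div_add_atTop_nhds_zero_nat (𝕜 := ℝ))
        rwa [ENNReal.ofReal_zero] at this
      filter_upwards [hlim.eventually (eventually_lt_nhds hpos)] with n hn _ using hn
  -- One integer controls both parameters: `1 / (n + 1)` is below the distances from `q` to the
  -- other sets and `n + 1` is above `‖u‖`. Countably many pieces then suffice.
  obtain ⟨n, hn, hun⟩ := (hfar.and (eventually_ge_atTop ⌈‖u‖⌉₊)).exists
  refine ⟨J, j₀, n, ⟨(hmemJ j₀).2 hj₀, fun j hj => hbody j ((hmemJ j).1 hj)⟩, q + u,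
    ⟨⟨fun j hj => ?_, fun j hj => ?_⟩, ?_⟩, ?_⟩
  · rw [hnear j₀ hj₀, hnear j ((hmemJ j).1 hj)]
    exact ⟨(hmemJ j).1 hj, rfl⟩
  · rw [hnear j₀ hj₀]
    exact hn j fun hqj => hj ((hmemJ j).2 hqj)
  · rw [mem_ofPred_eq, hnear j₀ hj₀, dist_eq_norm, add_sub_cancel_left]
    refine ⟨norm_pos_iff.2 hu0, ?_⟩
    have h1 : ‖u‖ ≤ n := (Nat.le_ceil _).trans (by exact_mod_cast hun)
    linarith
  · simp only
    rw [hnear j₀ hj₀, add_sub_cancel_left, hPq, hu, h.add_apply]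

/-- Countably many images of contact shells cover almost all of a piece of positive volume, so one
image is not null. The points of that shell satisfying the rank conditions are then not null either,
and its Steiner coefficient of degree `d - k` is positive. -/
theorem IsConvexRepr.scalingExponent_castSucc (hA : IsConvexRepr A m K) (hpos : 0 < volume A)
    (k : Fin d) : scalingExponent k.castSucc A = ((0 : ℝ) : EReal) := by
  refine hA.scalingExponent_eq_zero ?_
  obtain ⟨P, Q, h, hP, hQ⟩ := exists_isSplitting k.2.le
  obtain ⟨i₀, hi₀⟩ : ∃ i, volume (K i) ≠ 0 := by
    by_contra! hcon
    rw [hA.2] at hpos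
    exact hpos.ne' (measure_iUnion_null hcon)
  have hker : LinearMap.ker Q.toLinearMap ≠ ⊤ := by
    intro htop
    rw [LinearMap.ker_eq_top] at htop
    rw [htop, LinearMap.range_zero, finrank_bot] at hQ
    have := k.2
    omega
  have hae := ae_exists_mem_contactSet h hA hker i₀
  obtain ⟨J, j₀, n, ⟨hj₀, hJ⟩, hvol⟩ : ∃ (J : Finset (Fin m)) (j₀ : Fin m) (n : ℕ),
      (j₀ ∈ J ∧ ∀ j ∈ J, IsBody (K j)) ∧
      volume ((fun x => P (nearestPoint (K j₀) x) + Q (x - nearestPoint (K j₀) x)) ''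
        shell (K j₀) (contactSet K J j₀ (1 / ((n : ℝ) + 1))) ((n : ℝ) + 1)) ≠ 0 := by
    by_contra! hcon
    refine hi₀ ?_
    have hnull : ∀ᵐ z, ∀ (J : Finset (Fin m)) (j₀ : Fin m) (n : ℕ),
        (j₀ ∈ J ∧ ∀ j ∈ J, IsBody (K j)) →
        z ∉ (fun x => P (nearestPoint (K j₀) x) + Q (x - nearestPoint (K j₀) x)) ''
          shell (K j₀) (contactSet K J j₀ (1 / ((n : ℝ) + 1))) ((n : ℝ) + 1) := by
      simp only [ae_all_iff]
      exact fun J j₀ n hcond => measure_eq_zero_iff_ae_notMem.1 (hcon J j₀ n hcond)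
    rw [measure_eq_zero_iff_ae_notMem]
    filter_upwards [hae, hnull] with z h1 h2 hz
    obtain ⟨J, j₀, n, hcond, hmem⟩ := h1 hz
    exact h2 J j₀ n hcond hmem
  have hρ : (0 : ℝ) < 1 / ((n : ℝ) + 1) := by positivity
  obtain ⟨G, hG, hGe, hGpos⟩ := (hJ j₀ hj₀).exists_shell_polynomial
    (measurableSet_contactSet (ρ := 1 / ((n : ℝ) + 1)) hJ hj₀) (isRayInvariant_contactSet hJ hj₀)
    (R := (n : ℝ) + 1) (by positivity)
  refine hA.not_tendsto_curvatureVar hJ hj₀ hρ hG hGe (hGpos k k.2.le fun hzero => hvol ?_)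
  refine h.volume_image_eq_zero (hJ j₀ hj₀) ?_
  rw [hP, hQ]
  exact hzero

end

end FractalCurvature

theorem mainTheorem5 {d : ℕ} (k : Fin d) (A : Set (FractalCurvature.E d))
    (hA : FractalCurvature.SpecificCurvatureWellDefined A) (r : ℝ) (hr : 0 < r) :
    (FractalCurvature.IsPolyconvex A → 0 < volume A →
      FractalCurvature.SpecificCurvatureWellDefined (r • A) ∧
      FractalCurvature.specificCurvature k (r • A) =
        r ^ (((k : ℕ) : ℤ) - (d : ℤ)) * FractalCurvature.specificCurvature k A) ∧
    (∀ s : ℝ, (∀ j : Fin (d + 1),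
        FractalCurvature.scalingExponent j A = ((s - ((j : ℕ) : ℝ) : ℝ) : EReal)) →
      FractalCurvature.SpecificCurvatureWellDefined (r • A) ∧
      FractalCurvature.specificCurvature k (r • A) = FractalCurvature.specificCurvature k A) := by
  constructor
  · rintro ⟨m, K, hK⟩ hpos
    have hs : ∀ j, FractalCurvature.scalingExponent j A = ((0 : ℝ) : EReal) :=
      Fin.lastCases (hK.scalingExponent_last hpos) fun k => hK.scalingExponent_castSucc hpos k
    have h := FractalCurvature.specificCurvature_smul (k := k) hA hr (s := fun _ => 0) hs
    refine ⟨h.1, h.2.trans ?_⟩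
    congr 1
    rw [← Real.rpow_intCast]
    push_cast
    ring_nf
  · intro s hs
    have h := FractalCurvature.specificCurvature_smul (k := k) hA hr
      (s := fun j => s - ((j : ℕ) : ℝ)) hs
    refine ⟨h.1, h.2.trans ?_⟩
    -- The exponent is `(s - k) + k - ((s - d) + d) = 0`.
    simp
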